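/- Let $p$ be a prime and let $|\cdot|_p$ be the absolute value on $\mathbb{Q}_p$ with $|p|_p=p^{-1}$. The height $H(P)$ of $P\in\mathbb{Z}[X]$ is the maximum of the absolute values of its coefficients; the height $H(\alpha)$ and the degree of an algebraic number $\alpha\in\mathbb{Q}_p$ are those of its minimal polynomial over $\mathbb{Z}$ (irreducible, primitive, with positive leading coefficient). For $\xi\in\mathbb{Q}_p$ and an integer $n\ge 1$, let $w_n(\xi)$ (resp. $w_n^*(\xi)$) be the supremum of the real numbers $w$ (resp. $w^*$) such that $$0<|P(\xi)|_p\le H(P)^{-w-1}\qquad\bigl(\text{resp. } 0<|\xi-\alpha|_p\le H(\alpha)^{-w^*-1}\bigr)$$ for infinitely many $P\in\mathbb{Z}[X]$ of degree at most $n$ (resp. infinitely many algebraic numbers $\alpha\in\mathbb{Q}_p$ of degree at most $n$). For a sequence $(a_n)_{n\ge 1}$ of positive integers, let $$[a_1,a_2,a_3,\ldots]=\cfrac{p^{a_1}}{1+\cfrac{p^{a_2}}{1+\cfrac{p^{a_3}}{1+\cdots}}}\in\mathbb{Q}_p$$ be the Schneider continued fraction (the $p$-adic limit of its finite truncations). **Theorem.**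 Let $d\ge 2$ be an integer and $w\ge 121d^2$ a real number. Let $b$ be a positive integer, $(\varepsilon_j)_{j\ge 0}$ a sequence in $\{0,1\}$, and $0<\eta<\sqrt{w}/d$ a real number. Let $(a_{n,w,\eta})_{n\ge 1}$ be the sequence given by $$a_{n,w,\eta}=\begin{cases} b+4i+3 & \text{if } n=\lfloor w^i\rfloor \text{ for some integer } i\ge 0,\\ b+4i+2 & \text{if } \lfloor w^i\rfloor<n<\lfloor w^{i+1}\rfloor \text{ for some integer } i\ge 0 \text{ and } n-\lfloor w^i\rfloor \text{ is a multiple of } \lfloor \eta w^i\rfloor,\\ b+4i+\varepsilon_i & \text{if } \lfloor w^i\rfloor<n<\lfloor w^{i+1}\rfloor \text{ for some integer } i\ge 0 \text{ and } n-\lfloor w^i\rfloor \text{ is not a multiple of } \lfloor \eta w^i\rfloor \end{cases}$$ (if $\lfloor\eta w^i\rfloor=0$, no positive integer is a multiple of it), and set $\xi_{w,\eta}:=[a_{1,w,\eta},a_{2,w,\eta},\ldots]\in\mathbb{Q}_p$. Then, for all $2\le n\le d$, $$w_n^*(\xi_{w,\eta})=\frac{2w-2-\eta}{2+\eta},\qquad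 w_n(\xi_{w,\eta})=\frac{2w-\eta}{2+\eta},$$ and hence $$w_n(\xi_{w,\eta})-w_n^*(\xi_{w,\eta})=\frac{2}{2+\eta}.$$ -/

import Mathlib

open Polynomial Filter Topology

/-! ### Diophantine exponents of `p`-adic numbers

The height `H(P)` of an integer polynomial is `P.supNorm`, the maximum of the absolute values of
its coefficients. -/

/-- The set of real `w` such that `0 < |P(ξ)|_p ≤ H(P)^(-w-1)` for infinitely many `P ∈ ℤ[X]` of
degree at most `n`. -/
def mahlerSet (p : ℕ) [Fact p.Prime] (n : ℕ) (ξ : ℚ_[p]) : Set ℝ :=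
  {w | {P : ℤ[X] | P.natDegree ≤ n ∧ 0 < ‖aeval ξ P‖ ∧
    ‖aeval ξ P‖ ≤ P.supNorm ^ (-w - 1)}.Infinite}

/-- The exponent `w_n(ξ)`, as an extended real number. -/
noncomputable def mahlerExponent (p : ℕ) [Fact p.Prime] (n : ℕ) (ξ : ℚ_[p]) : EReal :=
  sSup ((fun w : ℝ => (w : EReal)) '' mahlerSet p n ξ)

/-- `P` is the minimal polynomial over `ℤ` of the algebraic number `α`: non-constant, irreducible,
primitive, with positive leading coefficient, and vanishing at `α`. -/
structure IsIntMinpoly {K : Type*} [CommRing K] (P : ℤ[X]) (α : K) : Prop where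
  natDegree_pos : 0 < P.natDegree
  irreducible : Irreducible P
  isPrimitive : P.IsPrimitive
  leadingCoeff_pos : 0 < P.leadingCoeff
  aeval_eq_zero : aeval α P = 0

/-- The set of real `w` such that `0 < |ξ - α|_p ≤ H(α)^(-w-1)` for infinitely many algebraic
numbers `α ∈ ℚ_p` of degree at most `n`; degree and height of `α` are those of its minimal
polynomial over `ℤ`. -/
def koksmaSet (p : ℕ) [Fact p.Prime] (n : ℕ) (ξ : ℚ_[p]) : Set ℝ :=
  {w | {α : ℚ_[p] | ∃ P : ℤ[X], IsIntMinpoly P α ∧ P.natDegree ≤ n ∧ 0 < ‖ξ - α‖ ∧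
    ‖ξ - α‖ ≤ P.supNorm ^ (-w - 1)}.Infinite}

/-- The exponent `w_n^*(ξ)`, as an extended real number. -/
noncomputable def koksmaExponent (p : ℕ) [Fact p.Prime] (n : ℕ) (ξ : ℚ_[p]) : EReal :=
  sSup ((fun w : ℝ => (w : EReal)) '' koksmaSet p n ξ)

/-! ### Schneider continued fractions -/

/-- The finite Schneider continued fraction
`p^(a 0) / (1 + p^(a 1) / (1 + ⋯ + p^(a (n - 1)) / 1))`, with `n` levels. -/
noncomputable def schneiderConvergent (p : ℕ) [Fact p.Prime] : ℕ → (ℕ → ℕ) → ℚ_[p]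
  | 0, _ => 0
  | n + 1, a => (p : ℚ_[p]) ^ a 0 / (1 + schneiderConvergent p n fun k => a (k + 1))

/-- The Schneider continued fraction `p^(a 0) / (1 + p^(a 1) / (1 + p^(a 2) / (1 + ⋯)))`, the
`p`-adic limit of its convergents. -/
noncomputable def schneiderCF (p : ℕ) [Fact p.Prime] (a : ℕ → ℕ) : ℚ_[p] :=
  limUnder atTop fun n => schneiderConvergent p n a

theorem norm_one_add_of_norm_lt_one {p : ℕ} [Fact p.Prime] {x : ℚ_[p]} (hx : ‖x‖ < 1) :
    ‖1 + x‖ = 1 := by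
  rw [IsUltrametricDist.norm_add_eq_max_of_norm_ne_norm (by rw [norm_one]; exact hx.ne'),
    norm_one, max_eq_left hx.le]

theorem norm_p_pow_le (p : ℕ) [hp : Fact p.Prime] {m : ℕ} (hm : 0 < m) :
    ‖(p : ℚ_[p]) ^ m‖ ≤ 1 / 2 := by
  have h2 : (2 : ℝ) ≤ p := by exact_mod_cast hp.out.two_le
  have h1 : ‖(p : ℚ_[p])‖ ≤ 1 / 2 := by
    rw [Padic.norm_p, one_div]
    exact inv_anti₀ (by norm_num) h2
  rw [norm_pow]
  exact (pow_le_of_le_one (norm_nonneg _) (h1.trans (by norm_num)) hm.ne').trans h1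

theorem norm_schneiderConvergent_lt_one (p : ℕ) [Fact p.Prime] (n : ℕ) :
    ∀ a : ℕ → ℕ, (∀ k, 0 < a k) → ‖schneiderConvergent p n a‖ < 1 := by
  induction n with
  | zero => intro a _; simp [schneiderConvergent]
  | succ n ih =>
    intro a ha
    have h := norm_one_add_of_norm_lt_one (ih (fun k => a (k + 1)) fun k => ha _)
    rw [schneiderConvergent, norm_div, h, div_one]
    exact (norm_p_pow_le p (ha 0)).trans_lt (by norm_num)

theorem norm_schneiderConvergent_sub_le (p : ℕ) [Fact p.Prime] (n : ℕ) :
    ∀ a : ℕ → ℕ, (∀ k, 0 < a k) →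
      ‖schneiderConvergent p n a - schneiderConvergent p (n + 1) a‖ ≤ 1 * (1 / 2) ^ n := by
  induction n with
  | zero =>
    intro a ha
    have h := norm_schneiderConvergent_lt_one p 1 a ha
    simpa [schneiderConvergent] using h.le
  | succ n ih =>
    intro a ha
    have hb : ∀ k, 0 < (fun k => a (k + 1)) k := fun k => ha _
    have h1 := norm_one_add_of_norm_lt_one (norm_schneiderConvergent_lt_one p n _ hb)
    have h2 := norm_one_add_of_norm_lt_one (norm_schneiderConvergent_lt_one p (n + 1) _ hb)
    have h3 := ih _ hb
    rw [schneiderConvergent, schneiderConvergent.eq_2 p a (n + 1)]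
    generalize schneiderConvergent p n (fun k => a (k + 1)) = x at *
    generalize schneiderConvergent p (n + 1) (fun k => a (k + 1)) = y at *
    have hx : 1 + x ≠ 0 := fun h => by simp [h] at h1
    have hy : 1 + y ≠ 0 := fun h => by simp [h] at h2
    have e : (p : ℚ_[p]) ^ a 0 / (1 + x) - (p : ℚ_[p]) ^ a 0 / (1 + y)
        = (p : ℚ_[p]) ^ a 0 * (-(x - y)) / ((1 + x) * (1 + y)) := by
      field_simp
      ring
    rw [e, norm_div, norm_mul, norm_mul, h1, h2, norm_neg, mul_one, div_one, pow_succ]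
    have h4 := mul_le_mul (norm_p_pow_le p (ha 0)) h3 (norm_nonneg _) (by norm_num)
    linarith

/-- The convergents of a Schneider continued fraction with positive exponents converge to it. -/
theorem tendsto_schneiderConvergent (p : ℕ) [Fact p.Prime] (a : ℕ → ℕ) (ha : ∀ k, 0 < a k) :
    Tendsto (fun n => schneiderConvergent p n a) atTop (𝓝 (schneiderCF p a)) := by
  have h : CauchySeq fun n => schneiderConvergent p n a :=
    cauchySeq_of_le_geometric (1 / 2) 1 (by norm_num) fun n => by
      rw [dist_eq_norm]; exact norm_schneiderConvergent_sub_le p n a ha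
  exact tendsto_nhds_limUnder (cauchySeq_tendsto_of_complete h)

/-! ### The sequence of exponents -/

/-- For `2 ≤ w` and `1 ≤ n`, the unique `i` with `⌊w^i⌋ ≤ n < ⌊w^(i+1)⌋`. -/
noncomputable def blockIndex (w : ℝ) (n : ℕ) : ℕ :=
  Nat.findGreatest (fun i => ⌊w ^ i⌋₊ ≤ n) n

/-- The sequence `a_n` (`1 ≤ n`): if `i` is the index with `⌊w^i⌋ ≤ n < ⌊w^(i+1)⌋`, then `a_n` is
`b + 4 i + 3` if `n = ⌊w^i⌋`; it is `b + 4 i + 2` if `n > ⌊w^i⌋` and `⌊η w^i⌋` divides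
`n - ⌊w^i⌋`; and it is `b + 4 i + ε_i` otherwise. -/
noncomputable def schneiderExponents (w η : ℝ) (b : ℕ) (ε : ℕ → ℕ) (n : ℕ) : ℕ :=
  let i := blockIndex w n
  if n = ⌊w ^ i⌋₊ then b + 4 * i + 3
  else if ⌊η * w ^ i⌋₊ ∣ n - ⌊w ^ i⌋₊ then b + 4 * i + 2
  else b + 4 * i + ε i

theorem blockIndex_eq {w : ℝ} (hw : 2 ≤ w) {i n : ℕ} (h1 : ⌊w ^ i⌋₊ ≤ n)
    (h2 : n < ⌊w ^ (i + 1)⌋₊) : blockIndex w n = i := by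
  have hi : i < ⌊w ^ i⌋₊ := by
    have h : (2 : ℝ) ^ i ≤ w ^ i := pow_le_pow_left₀ (by norm_num) hw i
    have h' : 2 ^ i ≤ ⌊w ^ i⌋₊ := Nat.le_floor (by exact_mod_cast h)
    exact Nat.lt_two_pow_self.trans_le h'
  refine Nat.findGreatest_eq_iff.2 ⟨(hi.trans_le h1).le, fun _ => h1, fun j hj _ hjn => ?_⟩
  have : ⌊w ^ (i + 1)⌋₊ ≤ ⌊w ^ j⌋₊ :=
    Nat.floor_le_floor (pow_le_pow_right₀ (by linarith) hj)
  omega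

theorem schneiderExponents_floor {w : ℝ} (hw : 2 ≤ w) (η : ℝ) (b : ℕ) (ε : ℕ → ℕ) (i : ℕ) :
    schneiderExponents w η b ε ⌊w ^ i⌋₊ = b + 4 * i + 3 := by
  have h : ⌊w ^ i⌋₊ < ⌊w ^ (i + 1)⌋₊ := by
    have h1 : 1 ≤ w ^ i := one_le_pow₀ (by linarith)
    refine Nat.lt_of_succ_le (Nat.le_floor ?_)
    have := Nat.floor_le (zero_le_one.trans h1)
    push_cast
    rw [pow_succ]
    nlinarith
  simp [schneiderExponents, blockIndex_eq hw le_rfl h]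

theorem schneiderExponents_of_dvd {w : ℝ} (hw : 2 ≤ w) (η : ℝ) (b : ℕ) (ε : ℕ → ℕ) {i n : ℕ}
    (h1 : ⌊w ^ i⌋₊ < n) (h2 : n < ⌊w ^ (i + 1)⌋₊) (h : ⌊η * w ^ i⌋₊ ∣ n - ⌊w ^ i⌋₊) :
    schneiderExponents w η b ε n = b + 4 * i + 2 := by
  simp [schneiderExponents, blockIndex_eq hw h1.le h2, h1.ne', h]

theorem schneiderExponents_of_not_dvd {w : ℝ} (hw : 2 ≤ w) (η : ℝ) (b : ℕ) (ε : ℕ → ℕ) {i n : ℕ}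
    (h1 : ⌊w ^ i⌋₊ < n) (h2 : n < ⌊w ^ (i + 1)⌋₊) (h : ¬ ⌊η * w ^ i⌋₊ ∣ n - ⌊w ^ i⌋₊) :
    schneiderExponents w η b ε n = b + 4 * i + ε i := by
  simp [schneiderExponents, blockIndex_eq hw h1.le h2, h1.ne', h]

/-- The `p`-adic number `ξ = [a_1, a_2, a_3, …]` for the sequence `a_n` above. -/
noncomputable def schneiderXi (p : ℕ) [Fact p.Prime] (w η : ℝ) (b : ℕ) (ε : ℕ → ℕ) : ℚ_[p] :=
  schneiderCF p fun k => schneiderExponents w η b ε (k + 1)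

/-- The convergents of the continued fraction `[a_1, a_2, a_3, …]` converge to `ξ`. -/
theorem tendsto_schneiderXi (p : ℕ) [Fact p.Prime] (w η : ℝ) (b : ℕ) (hb : 1 ≤ b) (ε : ℕ → ℕ) :
    Tendsto (fun n => schneiderConvergent p n fun k => schneiderExponents w η b ε (k + 1)) atTop
      (𝓝 (schneiderXi p w η b ε)) := by
  refine tendsto_schneiderConvergent p _ fun k => ?_
  simp only [schneiderExponents]
  split_ifs <;> omega

/-! ### Heights of integer polynomials -/

/-! Put r = ⌊w^i⌋ and s = ⌊η w^i⌋. After its first r exponents, ξ repeats the word (e, …, e, f) of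
length s, with e = b+4i+ε_i and f = b+4i+2, until the larger exponent opening block i+1 breaks the
pattern. Continuing the word for ever gives a quadratic number α_i. Let S_n be the sum of the first
n exponents and T_i = i w^i log p. Exponents in block i are 4i + O(1) and earlier blocks contribute
only to the error, so S_n is 4 c i w^i + O(w^i) for n close to c w^i. Three quantities are then
known asymptotically.

The distance |ξ-α_i| is governed by the first disagreement, so its negative logarithm is about 4w
T_i (`norm_schneiderCF_sub`). The polynomial of α_i is that of the fixed points of R N R⁻¹, with R
the matrix of the preperiod and N that of the period; its value at ξ is an explicit product, of
negative logarithm about 4(w+1) T_i (`norm_aeval_fixedPointPoly_schneiderCF`). Its height has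
logarithm about (S_r + S_(r+s)) log p / 2, that is 2(2+η) T_i: convergents bound it from above and
the discriminant from below. Dividing by the content is harmless, because the content is at most
p^(2f) and f = O(i); irreducibility holds because the discriminant is not a square. These facts are
collected in `exists_quadratic_approximation`. The ratios 4w/(2(2+η)) and 4(w+1)/(2(2+η)), less 1,
are the two exponents.

That nothing does better is a Liouville argument valid for any such sequence Q_i
(`QuadraticApproximations`). If Q_i does not divide P, their resultant is a nonzero integer, small
p-adically when both values at ξ are small, and its archimedean size is controlled by the heights.
Choosing i least with Q_i(ξ) small enough, and using T_(i+1)/T_i → w, one bounds |P(ξ)| below with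
an exponent that w ≥ 121d² makes smaller than the claimed ones (`exponent_inequalities`). Multiples
of Q_i are treated by induction on the degree through Gelfond's inequality. For algebraic
approximations the only remaining competitor is the conjugate of α_i, which is much farther from ξ.
-/

theorem one_le_supNorm {P : ℤ[X]} (hP : P ≠ 0) : 1 ≤ P.supNorm := by
  refine le_trans ?_ (P.le_supNorm P.natDegree)
  rw [Int.norm_eq_abs]
  exact_mod_cast Int.one_le_abs (leadingCoeff_ne_zero.2 hP)

theorem abs_coeff_le_supNorm (P : ℤ[X]) (i : ℕ) : |(P.coeff i : ℝ)| ≤ P.supNorm := by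
  simpa [Int.norm_eq_abs] using P.le_supNorm i

theorem supNorm_neg_int (P : ℤ[X]) : (-P).supNorm = P.supNorm := by
  simp [supNorm_eq_iSup]

theorem supNorm_C_mul_int (a : ℤ) (P : ℤ[X]) : (C a * P).supNorm = |(a : ℝ)| * P.supNorm := by
  obtain ⟨i, hi⟩ := P.exists_eq_supNorm
  obtain ⟨j, hj⟩ := (C a * P).exists_eq_supNorm
  apply le_antisymm
  · rw [hj, coeff_C_mul, Int.norm_eq_abs, Int.cast_mul, abs_mul]
    exact mul_le_mul_of_nonneg_left (abs_coeff_le_supNorm P j) (abs_nonneg _)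
  · rw [hi, Int.norm_eq_abs, ← abs_mul, ← Int.cast_mul, ← coeff_C_mul]
    exact abs_coeff_le_supNorm _ i

theorem supNorm_map_castRingHom (P : ℤ[X]) : (P.map (Int.castRingHom ℂ)).supNorm = P.supNorm := by
  simp [supNorm_eq_iSup, Int.norm_eq_abs]

/-- The Mahler measure is multiplicative and the height is not; the two are comparable up to
constants depending only on the degree bound. -/
theorem mahlerMeasure_map_le {P : ℤ[X]} {n : ℕ} (hn : P.natDegree ≤ n) :
    (P.map (Int.castRingHom ℂ)).mahlerMeasure ≤ (n + 1) * P.supNorm := by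
  have h := mahlerMeasure_le_sqrt_natDegree_add_one_mul_supNorm (P.map (Int.castRingHom ℂ))
  rw [supNorm_map_castRingHom] at h
  refine h.trans (mul_le_mul_of_nonneg_right ?_ P.supNorm_nonneg)
  have h1 : ((P.map (Int.castRingHom ℂ)).natDegree : ℝ) ≤ n := by
    exact_mod_cast natDegree_map_le.trans hn
  rw [Real.sqrt_le_left (by positivity)]
  nlinarith [(n.cast_nonneg : (0 : ℝ) ≤ n)]

theorem supNorm_le_mahlerMeasure_map {P : ℤ[X]} {n : ℕ} (hn : P.natDegree ≤ n) :
    P.supNorm ≤ 2 ^ n * (P.map (Int.castRingHom ℂ)).mahlerMeasure := by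
  have h := supNorm_le_choose_natDegree_div_two_mul_mahlerMeasure (P.map (Int.castRingHom ℂ))
  rw [supNorm_map_castRingHom] at h
  refine h.trans (mul_le_mul_of_nonneg_right ?_ (mahlerMeasure_nonneg _))
  have h1 := Nat.choose_le_two_pow (P.map (Int.castRingHom ℂ)).natDegree
    ((P.map (Int.castRingHom ℂ)).natDegree / 2)
  have h2 : 2 ^ (P.map (Int.castRingHom ℂ)).natDegree ≤ 2 ^ n :=
    Nat.pow_le_pow_right (by norm_num) (natDegree_map_le.trans hn)
  exact_mod_cast h1.trans h2

/-- Gelfond's inequality for a product of two integer polynomials. -/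
theorem supNorm_mul_supNorm_le {A B : ℤ[X]} {n : ℕ} (hA : A ≠ 0) (hB : B ≠ 0)
    (hn : (A * B).natDegree ≤ n) :
    A.supNorm * B.supNorm ≤ 2 ^ n * 2 ^ n * (n + 1) * (A * B).supNorm := by
  have hAB := natDegree_mul hA hB
  have h1 := supNorm_le_mahlerMeasure_map (P := A) (n := n) (by omega)
  have h2 := supNorm_le_mahlerMeasure_map (P := B) (n := n) (by omega)
  have h3 := mahlerMeasure_map_le hn
  rw [Polynomial.map_mul, mahlerMeasure_mul] at h3
  calc A.supNorm * B.supNorm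
      ≤ (2 ^ n * (A.map (Int.castRingHom ℂ)).mahlerMeasure) *
        (2 ^ n * (B.map (Int.castRingHom ℂ)).mahlerMeasure) :=
        mul_le_mul h1 h2 B.supNorm_nonneg (mul_nonneg (by positivity) (mahlerMeasure_nonneg _))
    _ = 2 ^ n * 2 ^ n * ((A.map (Int.castRingHom ℂ)).mahlerMeasure *
        (B.map (Int.castRingHom ℂ)).mahlerMeasure) := by ring
    _ ≤ 2 ^ n * 2 ^ n * ((n + 1) * (A * B).supNorm) := by gcongr
    _ = _ := by ring

/-- Northcott's property: bounding heights is enough to contradict the infinitude in the definitions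
of the exponents. -/
theorem finite_supNorm_le (n : ℕ) (B : ℝ) :
    {P : ℤ[X] | P.natDegree ≤ n ∧ P.supNorm ≤ B}.Finite := by
  refine (finite_mahlerMeasure_le n (Real.toNNReal ((n + 1) * B))).subset fun P hP => ⟨hP.1, ?_⟩
  refine (mahlerMeasure_map_le hP.1).trans (le_trans ?_ (Real.le_coe_toNNReal _))
  have := hP.2
  gcongr

/-! ### Resultants -/

/-- Leibniz expansion of the Sylvester determinant: each term takes `m` coefficients of `Q` and `n`
of `P`. -/
theorem abs_resultant_le (P Q : ℤ[X]) (m n : ℕ) :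
    |((resultant P Q m n : ℤ) : ℝ)| ≤ (m + n).factorial * (Q.supNorm ^ m * P.supNorm ^ n) := by
  rw [resultant, Matrix.det_apply, Int.cast_sum]
  refine (Finset.abs_sum_le_sum_abs _ _).trans ?_
  have h : ∀ σ ∈ (Finset.univ : Finset (Equiv.Perm (Fin (m + n)))),
      |((Equiv.Perm.sign σ • ∏ i, sylvester P Q m n (σ i) i : ℤ) : ℝ)|
        ≤ Q.supNorm ^ m * P.supNorm ^ n := by
    intro σ _
    have e : |((Equiv.Perm.sign σ • ∏ i, sylvester P Q m n (σ i) i : ℤ) : ℝ)|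
        = ∏ i, |(sylvester P Q m n (σ i) i : ℝ)| := by
      rw [← Finset.abs_prod]
      rcases Int.units_eq_one_or (Equiv.Perm.sign σ) with h | h <;> simp [h]
    rw [e, Fin.prod_univ_add]
    refine mul_le_mul ?_ ?_ (Finset.prod_nonneg fun _ _ => abs_nonneg _)
      (pow_nonneg Q.supNorm_nonneg _)
    · calc _ ≤ ∏ _i : Fin m, Q.supNorm := Finset.prod_le_prod (fun _ _ => abs_nonneg _) fun i _ => by
            simp only [sylvester, Matrix.of_apply, Fin.addCases_left]
            split_ifs
            · exact abs_coeff_le_supNorm _ _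
            · simpa using Q.supNorm_nonneg
        _ = _ := by simp
    · calc _ ≤ ∏ _i : Fin n, P.supNorm := Finset.prod_le_prod (fun _ _ => abs_nonneg _) fun i _ => by
            simp only [sylvester, Matrix.of_apply, Fin.addCases_right]
            split_ifs
            · exact abs_coeff_le_supNorm _ _
            · simpa using P.supNorm_nonneg
        _ = _ := by simp
  refine (Finset.sum_le_card_nsmul _ _ _ h).trans_eq ?_
  simp [Finset.card_univ, Fintype.card_perm]

/-- By Gauss's lemma irreducibility and non-divisibility pass to ℚ[X], where they give coprimality.
-/
theorem resultant_ne_zero_of_irreducible {P Q : ℤ[X]} (hQ : Irreducible Q)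
    (hd : Q.natDegree ≠ 0) (h : ¬ Q ∣ P) : resultant P Q ≠ 0 := by
  have hp : Q.IsPrimitive := hQ.isPrimitive hd
  have hirr := (IsPrimitive.Int.irreducible_iff_irreducible_map_cast hp).1 hQ
  have hnd : ¬ Q.map (Int.castRingHom ℚ) ∣ P.map (Int.castRingHom ℚ) := fun h' =>
    h ((IsPrimitive.Int.dvd_iff_map_cast_dvd_map_cast Q P hp).2 h')
  have hc : IsCoprime (P.map (Int.castRingHom ℚ)) (Q.map (Int.castRingHom ℚ)) :=
    ((hirr.coprime_iff_not_dvd).2 hnd).symm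
  have h1 : resultant (P.map (Int.castRingHom ℚ)) (Q.map (Int.castRingHom ℚ)) ≠ 0 := by
    rw [Ne, resultant_eq_zero_iff]
    exact fun h' => h'.2 hc
  intro h0
  apply h1
  have hinj : Function.Injective (Int.castRingHom ℚ) := Int.cast_injective
  rw [natDegree_map_eq_of_injective hinj, natDegree_map_eq_of_injective hinj, resultant_map_map,
    h0, map_zero]

/-! ### Values of integer polynomials at `p`-adic integers -/

section
variable {p : ℕ} [hp : Fact p.Prime]

theorem aeval_coe_padicInt (x : ℤ_[p]) (P : ℤ[X]) :
    aeval (x : ℚ_[p]) P = ((aeval x P : ℤ_[p]) : ℚ_[p]) :=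
  aeval_algebraMap_apply ℚ_[p] x P

theorem norm_aeval_int_le_one {ξ : ℚ_[p]} (hξ : ‖ξ‖ ≤ 1) (P : ℤ[X]) : ‖aeval ξ P‖ ≤ 1 := by
  obtain ⟨x, rfl⟩ : ∃ x : ℤ_[p], (x : ℚ_[p]) = ξ := ⟨⟨ξ, hξ⟩, rfl⟩
  rw [aeval_coe_padicInt]
  exact PadicInt.norm_le_one _

theorem norm_aeval_int_sub_le {ξ α : ℚ_[p]} (hξ : ‖ξ‖ ≤ 1) (hα : ‖α‖ ≤ 1) (P : ℤ[X]) :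
    ‖aeval ξ P - aeval α P‖ ≤ ‖ξ - α‖ := by
  obtain ⟨x, rfl⟩ : ∃ x : ℤ_[p], (x : ℚ_[p]) = ξ := ⟨⟨ξ, hξ⟩, rfl⟩
  obtain ⟨y, rfl⟩ : ∃ x : ℤ_[p], (x : ℚ_[p]) = α := ⟨⟨α, hα⟩, rfl⟩
  obtain ⟨c, hc⟩ := sub_dvd_eval_sub x y (P.map (algebraMap ℤ ℤ_[p]))
  rw [eval_map_algebraMap, eval_map_algebraMap] at hc
  rw [aeval_coe_padicInt, aeval_coe_padicInt, ← PadicInt.coe_sub, hc, PadicInt.coe_mul, norm_mul,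
    ← PadicInt.coe_sub]
  exact mul_le_of_le_one_right (norm_nonneg _) (PadicInt.norm_le_one c)

/-- The power of p dividing a nonzero integer is at most its absolute value; this is the Liouville
step of the whole argument. -/
theorem one_le_abs_mul_norm_int {z : ℤ} (hz : z ≠ 0) : 1 ≤ |(z : ℝ)| * ‖(z : ℚ_[p])‖ := by
  have hp0 : (0 : ℝ) < p := by exact_mod_cast hp.out.pos
  have h1 : ‖(z : ℚ_[p])‖ = (p : ℝ) ^ (-(padicValInt p z) : ℤ) := by
    rw [Padic.norm_eq_zpow_neg_valuation (by exact_mod_cast hz), Padic.valuation_intCast]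
  have h2 : (p ^ padicValInt p z : ℤ) ≤ |z| :=
    Int.le_of_dvd (abs_pos.2 hz) ((dvd_abs _ _).2 (padicValInt_dvd z))
  rw [h1, zpow_neg, ← div_eq_mul_inv, one_le_div (by positivity)]
  exact_mod_cast h2

/-- An irreducible integer polynomial `Q` not dividing `P` cannot be small together with `P`. -/
theorem one_le_mul_max_norm_aeval {ξ : ℚ_[p]} (hξ : ‖ξ‖ ≤ 1) {P Q : ℤ[X]} {n : ℕ}
    (hP : P.natDegree ≤ n) (hQ : Irreducible Q) (hd : Q.natDegree = 2) (h : ¬ Q ∣ P) :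
    1 ≤ (n + 2).factorial * (Q.supNorm ^ n * P.supNorm ^ 2) * max ‖aeval ξ P‖ ‖aeval ξ Q‖ := by
  have hr := resultant_ne_zero_of_irreducible hQ (by omega) h
  -- The resultant is an integral combination of `P` and `Q`, and the cofactors have norm at most 1
  -- at the p-adic integer ξ.
  obtain ⟨A, B, -, -, hAB⟩ := exists_mul_add_mul_eq_C_resultant P Q le_rfl le_rfl
    (by omega : P.natDegree ≠ 0 ∨ Q.natDegree ≠ 0)
  have h1 : ‖((resultant P Q : ℤ) : ℚ_[p])‖ ≤ max ‖aeval ξ P‖ ‖aeval ξ Q‖ := by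
    have h2 := congrArg (aeval ξ) hAB
    rw [map_add, map_mul, map_mul, aeval_C, algebraMap_int_eq, eq_intCast] at h2
    rw [← h2]
    refine (IsUltrametricDist.norm_add_le_max _ _).trans (max_le_max ?_ ?_) <;> rw [norm_mul]
    · exact mul_le_of_le_one_right (norm_nonneg _) (norm_aeval_int_le_one hξ _)
    · exact mul_le_of_le_one_right (norm_nonneg _) (norm_aeval_int_le_one hξ _)
  have h3 : |((resultant P Q : ℤ) : ℝ)| ≤ (n + 2).factorial * (Q.supNorm ^ n * P.supNorm ^ 2) := by
    refine (abs_resultant_le P Q _ _).trans ?_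
    rw [hd]
    have h4 : ((P.natDegree + 2).factorial : ℝ) ≤ (n + 2).factorial := by
      exact_mod_cast Nat.factorial_le (by omega)
    have h5 := pow_le_pow_right₀ (one_le_supNorm hQ.ne_zero) hP
    have := P.supNorm_nonneg
    have := Q.supNorm_nonneg
    gcongr
  exact (one_le_abs_mul_norm_int (p := p) hr).trans
    (mul_le_mul h3 h1 (norm_nonneg _) (by
      have := P.supNorm_nonneg
      have := Q.supNorm_nonneg
      positivity))

end

/-! ### Exponents of a number with a sequence of very good quadratic approximations -/

theorem sSup_coe_image_eq {S : Set ℝ} {s : ℝ} (h1 : ∀ w ∈ S, w ≤ s) (h2 : ∀ w < s, w ∈ S) :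
    sSup ((fun w : ℝ => (w : EReal)) '' S) = s := by
  apply le_antisymm
  · refine sSup_le ?_
    rintro _ ⟨w, hw, rfl⟩
    exact EReal.coe_le_coe_iff.2 (h1 w hw)
  · refine le_of_forall_lt fun c hc => ?_
    obtain ⟨r, hr1, hr2⟩ := EReal.lt_iff_exists_real_btwn.1 hc
    exact hr1.trans_le (le_sSup ⟨r, h2 r (EReal.coe_lt_coe_iff.1 hr2), rfl⟩)

theorem infinite_of_tendsto_atTop {X : Type*} {S : Set X} (f : X → ℝ) {x : ℕ → X}
    (hf : Tendsto (fun i => f (x i)) atTop atTop) (hx : ∀ᶠ i in atTop, x i ∈ S) : S.Infinite := by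
  intro hS
  obtain ⟨K, hK⟩ := (hS.image f).bddAbove
  obtain ⟨i, hi, hi'⟩ := ((hf.eventually_gt_atTop K).and hx).exists
  exact absurd (hK ⟨x i, hi', rfl⟩) (not_le.2 hi)

/-- A sequence growing at most geometrically does not jump far beyond a given bound. -/
theorem exists_lt_and_le_of_tendsto {T : ℕ → ℝ} (hT : Tendsto T atTop atTop) {θ : ℝ} (hθ : 0 ≤ θ)
    {i₀ : ℕ} (hg : ∀ i ≥ i₀, T (i + 1) ≤ θ * T i) (x : ℝ) :
    ∃ i ≥ i₀, x < T i ∧ (i = i₀ ∨ T i ≤ θ * x) := by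
  classical
  have hex : ∃ i, i₀ ≤ i ∧ x < T i :=
    ((eventually_ge_atTop i₀).and (hT.eventually_gt_atTop x)).exists
  refine ⟨Nat.find hex, (Nat.find_spec hex).1, (Nat.find_spec hex).2, ?_⟩
  by_cases h : Nat.find hex = i₀
  · exact Or.inl h
  · right
    have h0 := (Nat.find_spec hex).1
    obtain ⟨j, hj⟩ : ∃ j, Nat.find hex = j + 1 := ⟨Nat.find hex - 1, by omega⟩
    have hj' := Nat.find_min hex (m := j) (by omega)
    rw [hj]
    have : ¬ x < T j := fun h' => hj' ⟨by omega, h'⟩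
    exact (hg j (by omega)).trans (mul_le_mul_of_nonneg_left (not_lt.1 this) hθ)

/-- Irreducible quadratic polynomials `Q i` whose logarithmic heights are asymptotic to `h * T i`
and with `-log ‖Q i (ξ)‖` asymptotic to `A * T i`, where `T (i + 1)` is asymptotic to `w * T i`. -/
structure QuadraticApproximations {p : ℕ} [Fact p.Prime] (ξ : ℚ_[p]) (Q : ℕ → ℤ[X]) (T : ℕ → ℝ)
    (w h A : ℝ) : Prop where
  norm_le : ‖ξ‖ ≤ 1
  pos_w : 0 < w
  pos_h : 0 < h
  tendsto_T : Tendsto T atTop atTop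
  ratio : Tendsto (fun i => T (i + 1) / T i) atTop (𝓝 w)
  irreducible : ∀ᶠ i in atTop, Irreducible (Q i)
  natDegree : ∀ᶠ i in atTop, (Q i).natDegree = 2
  ne_zero : ∀ᶠ i in atTop, aeval ξ (Q i) ≠ 0
  height : Tendsto (fun i => Real.log (Q i).supNorm / T i) atTop (𝓝 h)
  value : Tendsto (fun i => -Real.log ‖aeval ξ (Q i)‖ / T i) atTop (𝓝 A)

theorem eventually_lt_of_tendsto_div {T f g : ℕ → ℝ} (hT : Tendsto T atTop atTop) {a b : ℝ}
    (hf : Tendsto (fun i => f i / T i) atTop (𝓝 a)) (hg : Tendsto (fun i => g i / T i) atTop (𝓝 b))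
    (hab : a < b) : ∀ᶠ i in atTop, f i < g i := by
  filter_upwards [hf.eventually_lt hg hab, hT.eventually_gt_atTop 0] with i h1 h2
  rwa [div_lt_div_iff_of_pos_right h2] at h1

theorem tendsto_const_mul_div {T f : ℕ → ℝ} {a : ℝ} (c : ℝ)
    (hf : Tendsto (fun i => f i / T i) atTop (𝓝 a)) :
    Tendsto (fun i => c * f i / T i) atTop (𝓝 (c * a)) := by
  simpa only [mul_div_assoc] using hf.const_mul c

theorem rpow_neg_le_of_neg_log_le {H x E : ℝ} (hH : 0 < H) (hx : 0 < x)
    (h : -Real.log x ≤ E * Real.log H) : H ^ (-E) ≤ x := by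
  rw [Real.rpow_def_of_pos hH, ← Real.le_log_iff_exp_le hx]
  linarith

theorem le_rpow_neg_of_le_neg_log {H x E : ℝ} (hH : 0 < H) (hx : 0 < x)
    (h : E * Real.log H ≤ -Real.log x) : x ≤ H ^ (-E) := by
  rw [Real.rpow_def_of_pos hH, ← Real.log_le_iff_le_exp hx]
  linarith

/-- If `c H^(-E) ≤ H^(-E')` with `E < E'` then `H` is bounded. -/
theorem le_rpow_inv_of_mul_rpow_le {c H E E' : ℝ} (hc : 0 < c) (hH : 0 < H) (hE : E < E')
    (h : c * H ^ (-E) ≤ H ^ (-E')) : H ≤ c⁻¹ ^ (E' - E)⁻¹ := by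
  have h1 : H ^ (E' - E) ≤ c⁻¹ := by
    rw [inv_eq_one_div, le_div_iff₀ hc]
    have h2 := mul_le_mul_of_nonneg_right h (Real.rpow_pos_of_pos hH E').le
    rw [← Real.rpow_add hH, mul_assoc, ← Real.rpow_add hH] at h2
    simp only [neg_add_cancel, Real.rpow_zero] at h2
    rwa [neg_add_eq_sub, mul_comm] at h2
  have h3 := Real.rpow_le_rpow (by positivity) h1 (inv_nonneg.2 (sub_pos.2 hE).le)
  rwa [← Real.rpow_mul hH.le, mul_inv_cancel₀ (sub_pos.2 hE).ne', Real.rpow_one] at h3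

/-! ### Lower bounds for polynomial values, and the exponent `w_n` -/

namespace QuadraticApproximations

variable {p : ℕ} [Fact p.Prime] {ξ : ℚ_[p]} {Q : ℕ → ℤ[X]} {T : ℕ → ℝ} {w h A : ℝ}

theorem tendsto_supNorm (hQ : QuadraticApproximations ξ Q T w h A) :
    Tendsto (fun i => (Q i).supNorm) atTop atTop := by
  have h1 : Tendsto (fun i => Real.log (Q i).supNorm) atTop atTop := by
    have := hQ.height.pos_mul_atTop hQ.pos_h hQ.tendsto_T
    refine this.congr' ?_
    filter_upwards [hQ.tendsto_T.eventually_gt_atTop 0] with i hi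
    field_simp
  refine tendsto_atTop_mono (fun i => ?_) h1
  exact Real.log_le_self (Q i).supNorm_nonneg

/-- Polynomials not divisible by any of the approximating polynomials are not small at `ξ`. -/
theorem dvd_or_le_norm_aeval (hQ : QuadraticApproximations ξ Q T w h A) {n : ℕ} {E : ℝ}
    (hn : n * h < A) (hE : 2 * (1 + n * h * w / (A - n * h)) < E) (i₀ : ℕ) :
    ∃ c > 0, ∀ P : ℤ[X], P ≠ 0 → P.natDegree ≤ n →
      (∃ i ≥ i₀, Q i ∣ P) ∨ c * P.supNorm ^ (-E) ≤ ‖aeval ξ P‖ := by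
  -- Both strict inequalities survive a small perturbation of `A`, `h` and `w`, so the limits can be
  -- replaced by genuine bounds with margin δ.
  obtain ⟨δ, ⟨hδ1, hδ2⟩, hδ⟩ : ∃ δ : ℝ, (0 < (A - δ) - n * (h + δ) ∧
      2 * (1 + n * (h + δ) * (w + δ) / ((A - δ) - n * (h + δ))) < E) ∧ 0 < δ := by
    have t1 : Tendsto (fun δ : ℝ => (A - δ) - n * (h + δ)) (𝓝[>] 0) (𝓝 (A - n * h)) := by
      refine Tendsto.mono_left ?_ nhdsWithin_le_nhds
      have : Continuous fun δ : ℝ => (A - δ) - n * (h + δ) := by fun_prop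
      simpa using this.tendsto 0
    have t2 : Tendsto (fun δ : ℝ => n * (h + δ) * (w + δ)) (𝓝[>] 0) (𝓝 (n * h * w)) := by
      refine Tendsto.mono_left ?_ nhdsWithin_le_nhds
      have : Continuous fun δ : ℝ => n * (h + δ) * (w + δ) := by fun_prop
      simpa using this.tendsto 0
    have hpos : 0 < A - n * h := by linarith
    have t3 := ((t2.div t1 hpos.ne').const_add 1).const_mul 2
    exact ((((t1.eventually_const_lt hpos).and (t3.eventually_lt_const hE)).and
      self_mem_nhdsWithin)).exists
  -- For large i, `κ * T i` is a lower bound for -log|Q_i(ξ)| - n log H(Q_i).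
  set κ := (A - δ) - n * (h + δ) with hκ
  have hh := hQ.pos_h
  have hw := hQ.pos_w
  have hev : ∀ᶠ i in atTop, Irreducible (Q i) ∧ (Q i).natDegree = 2 ∧ aeval ξ (Q i) ≠ 0 ∧
      0 < T i ∧ T (i + 1) / T i < w + δ ∧ Real.log (Q i).supNorm / T i < h + δ ∧
      A - δ < -Real.log ‖aeval ξ (Q i)‖ / T i := by
    filter_upwards [hQ.irreducible, hQ.natDegree, hQ.ne_zero, hQ.tendsto_T.eventually_gt_atTop 0,
      hQ.ratio.eventually_lt_const (lt_add_of_pos_right w hδ),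
      hQ.height.eventually_lt_const (lt_add_of_pos_right h hδ),
      hQ.value.eventually_const_lt (sub_lt_self A hδ)] with i h1 h2 h3 h4 h5 h6 h7
    exact ⟨h1, h2, h3, h4, h5, h6, h7⟩
  obtain ⟨i₁, hi₁⟩ := eventually_atTop.1 hev
  set i₂ := max i₀ i₁ with hi₂
  have hev2 : ∀ i ≥ i₂, _ := fun i hi => hi₁ i (le_trans (le_max_right _ _) hi)
  have hgrow : ∀ i ≥ i₂, T (i + 1) ≤ (w + δ) * T i := fun i hi => by
    obtain ⟨-, -, -, h4, h5, -, -⟩ := hev2 i hi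
    exact ((div_lt_iff₀ h4).1 h5).le
  set F : ℝ := ((n + 2).factorial : ℝ) with hF
  have hF1 : 1 ≤ F := by
    rw [hF]
    exact_mod_cast (n + 2).factorial_pos
  have hlF : 0 ≤ Real.log F := Real.log_nonneg hF1
  set L := n * (h + δ) * (w + δ) / κ with hL
  have hL0 : 0 ≤ L := by positivity
  have hT2 : 0 < T i₂ := (hev2 i₂ le_rfl).2.2.2.1
  -- The term in `T i₂` covers polynomials of small height, for which the search for i stops at its
  -- starting index.
  set K := n * (h + δ) * T i₂ + (1 + L) * Real.log F with hK
  refine ⟨Real.exp (-K), Real.exp_pos _, fun P hP0 hPn => ?_⟩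
  have hH1 := one_le_supNorm hP0
  have hlH : 0 ≤ Real.log P.supNorm := Real.log_nonneg hH1
  set x := Real.log F + 2 * Real.log P.supNorm with hx
  have hx0 : 0 ≤ x := by positivity
  -- The least i for which the resultant inequality rules out `Q i`; minimality bounds `T i`, hence
  -- H(Q_i), in terms of H(P).
  obtain ⟨i, hi, hxi, hor⟩ := exists_lt_and_le_of_tendsto hQ.tendsto_T (by positivity) hgrow (x / κ)
  by_cases hd : Q i ∣ P
  · exact Or.inl ⟨i, le_trans (le_max_left _ _) hi, hd⟩
  right
  obtain ⟨h1, h2, h3, h4, -, h6, h7⟩ := hev2 i hi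
  rw [div_lt_iff₀ h4] at h6
  rw [lt_div_iff₀ h4] at h7
  rw [div_lt_iff₀ hδ1] at hxi
  have hQ1 := one_le_supNorm h1.ne_zero
  have hmain := one_le_mul_max_norm_aeval hQ.norm_le hPn h1 h2 hd
  have hB : 0 < F * ((Q i).supNorm ^ n * P.supNorm ^ 2) := by positivity
  have hlogB : Real.log (F * ((Q i).supNorm ^ n * P.supNorm ^ 2))
      = x + n * Real.log (Q i).supNorm := by
    rw [Real.log_mul (by positivity) (by positivity), Real.log_mul (by positivity) (by positivity),
      Real.log_pow, Real.log_pow]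
    push_cast
    ring
  have hy : n * Real.log (Q i).supNorm ≤ n * ((h + δ) * T i) :=
    mul_le_mul_of_nonneg_left h6.le n.cast_nonneg
  -- By the choice of i the maximum in the resultant inequality cannot be |Q_i(ξ)|, so it is |P(ξ)|.
  have hsmall : F * ((Q i).supNorm ^ n * P.supNorm ^ 2) * ‖aeval ξ (Q i)‖ < 1 := by
    rw [← Real.log_neg_iff (mul_pos hB (norm_pos_iff.2 h3)),
      Real.log_mul hB.ne' (norm_ne_zero_iff.2 h3), hlogB]
    have : T i * κ = (A - δ) * T i - n * ((h + δ) * T i) := by rw [hκ]; ring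
    linarith
  have hP1 : 1 ≤ F * ((Q i).supNorm ^ n * P.supNorm ^ 2) * ‖aeval ξ P‖ := by
    rcases le_total ‖aeval ξ P‖ ‖aeval ξ (Q i)‖ with hle | hle
    · rw [max_eq_right hle] at hmain
      exact absurd hmain (not_le.2 hsmall)
    · rwa [max_eq_left hle] at hmain
  have hPpos : 0 < ‖aeval ξ P‖ := by
    by_contra h0
    have : ‖aeval ξ P‖ = 0 := le_antisymm (not_lt.1 h0) (norm_nonneg _)
    rw [this, mul_zero] at hP1
    linarith
  have hlog := Real.log_nonneg hP1
  rw [Real.log_mul hB.ne' hPpos.ne', hlogB] at hlog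
  have hTi : T i ≤ T i₂ + (w + δ) * (x / κ) := by
    have : 0 ≤ (w + δ) * (x / κ) := by positivity
    rcases hor with rfl | hor <;> linarith
  have hfin : -Real.log ‖aeval ξ P‖ ≤ K + E * Real.log P.supNorm := by
    have e1 : n * ((h + δ) * T i) ≤ n * ((h + δ) * (T i₂ + (w + δ) * (x / κ))) := by gcongr
    have e2 : n * ((h + δ) * (T i₂ + (w + δ) * (x / κ))) = n * (h + δ) * T i₂ + L * x := by
      rw [hL]; field_simp
    have e3 : 2 * (1 + L) * Real.log P.supNorm ≤ E * Real.log P.supNorm :=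
      mul_le_mul_of_nonneg_right hδ2.le hlH
    have e4 : x + L * x = (1 + L) * Real.log F + 2 * (1 + L) * Real.log P.supNorm := by
      rw [hx]; ring
    rw [hK]
    linarith
  rw [Real.rpow_def_of_pos (by linarith), ← Real.exp_add, ← Real.le_log_iff_exp_le hPpos]
  linarith

/-- Induction on the degree bound `k`. If P = Q_i R, both factors satisfy the bound with the same
exponent E > A/h, and Gelfond's inequality recombines the heights at the cost of a constant. -/
theorem exists_le_norm_aeval (hQ : QuadraticApproximations ξ Q T w h A) {n : ℕ} {E : ℝ}
    (hn : n * h < A) (hE : 2 * (1 + n * h * w / (A - n * h)) < E) (hA : A / h < E) (k : ℕ) :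
    ∃ c > 0, ∀ P : ℤ[X], P ≠ 0 → P.natDegree ≤ n → P.natDegree < k →
      c * P.supNorm ^ (-E) ≤ ‖aeval ξ P‖ := by
  have hE0 : 0 < E := by
    refine lt_of_le_of_lt ?_ hE
    have := hQ.pos_h
    have := hQ.pos_w
    have : 0 < A - n * h := by linarith
    positivity
  have hev : ∀ᶠ i in atTop, Irreducible (Q i) ∧ (Q i).natDegree = 2 ∧ aeval ξ (Q i) ≠ 0 ∧
      -Real.log ‖aeval ξ (Q i)‖ < E * Real.log (Q i).supNorm := by
    filter_upwards [hQ.irreducible, hQ.natDegree, hQ.ne_zero, eventually_lt_of_tendsto_div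
      hQ.tendsto_T hQ.value (tendsto_const_mul_div E hQ.height) ((div_lt_iff₀ hQ.pos_h).1 hA)]
      with i h1 h2 h3 h4
    exact ⟨h1, h2, h3, h4⟩
  obtain ⟨i₀, hi₀⟩ := eventually_atTop.1 hev
  obtain ⟨c₀, hc₀, hco⟩ := hQ.dvd_or_le_norm_aeval hn hE i₀
  induction k with
  | zero => exact ⟨1, one_pos, fun P _ _ h0 => absurd h0 (Nat.not_lt_zero _)⟩
  | succ k ih =>
    obtain ⟨c, hc, ih⟩ := ih
    set G : ℝ := 2 ^ n * 2 ^ n * (n + 1) with hG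
    have hG0 : 0 < G := by positivity
    refine ⟨min c₀ (c * G ^ (-E)), by positivity, fun P hP0 hPn hPk => ?_⟩
    have hHP : 0 < P.supNorm := one_pos.trans_le (one_le_supNorm hP0)
    rcases hco P hP0 hPn with ⟨i, hi, R, rfl⟩ | hle
    · obtain ⟨h1, h2, h3, h4⟩ := hi₀ i hi
      have hR0 : R ≠ 0 := right_ne_zero_of_mul hP0
      have hdeg := natDegree_mul h1.ne_zero hR0
      have hR := ih R hR0 (by omega) (by omega)
      have hHQ : 0 < (Q i).supNorm := one_pos.trans_le (one_le_supNorm h1.ne_zero)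
      have hHR : 0 < R.supNorm := one_pos.trans_le (one_le_supNorm hR0)
      have hQi := rpow_neg_le_of_neg_log_le hHQ (norm_pos_iff.2 h3) h4.le
      have hge := supNorm_mul_supNorm_le h1.ne_zero hR0 hPn
      rw [map_mul, norm_mul]
      calc min c₀ (c * G ^ (-E)) * (Q i * R).supNorm ^ (-E)
          ≤ c * G ^ (-E) * (Q i * R).supNorm ^ (-E) := by
            gcongr
            exact min_le_right _ _
        _ = c * (G * (Q i * R).supNorm) ^ (-E) := by
            rw [Real.mul_rpow hG0.le hHP.le, mul_assoc]
        _ ≤ c * ((Q i).supNorm * R.supNorm) ^ (-E) := by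
            exact mul_le_mul_of_nonneg_left
              (Real.rpow_le_rpow_of_nonpos (by positivity) hge (by linarith)) hc.le
        _ = (Q i).supNorm ^ (-E) * (c * R.supNorm ^ (-E)) := by
            rw [Real.mul_rpow hHQ.le hHR.le]; ring
        _ ≤ _ := by gcongr
    · refine le_trans ?_ hle
      gcongr
      exact min_le_left _ _

/-- The `Q i` themselves reach every exponent below A/h - 1; the uniform lower bound excludes any
larger one. -/
theorem mahlerExponent_eq (hQ : QuadraticApproximations ξ Q T w h A) {n : ℕ} (h2n : 2 ≤ n)
    (hn : n * h < A) (hE : 2 * (1 + n * h * w / (A - n * h)) < A / h) :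
    mahlerExponent p n ξ = ((A / h - 1 : ℝ) : EReal) := by
  refine sSup_coe_image_eq (fun v hv => ?_) fun v hv => ?_
  · by_contra hlt
    obtain ⟨E, hE1, hE2⟩ := exists_between (show A / h < v + 1 by linarith [not_le.1 hlt])
    obtain ⟨c, hc, hle⟩ := hQ.exists_le_norm_aeval hn (hE.trans hE1) hE1 (n + 1)
    refine hv ((finite_supNorm_le n (c⁻¹ ^ (v + 1 - E)⁻¹)).subset ?_)
    rintro P ⟨hPn, hP1, hP2⟩
    have hP0 : P ≠ 0 := by
      rintro rfl
      simp at hP1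
    refine ⟨hPn, le_rpow_inv_of_mul_rpow_le hc (one_pos.trans_le (one_le_supNorm hP0)) hE2 ?_⟩
    refine (hle P hP0 hPn (by omega)).trans (hP2.trans_eq ?_)
    congr 1
    ring
  · refine infinite_of_tendsto_atTop (fun P : ℤ[X] => P.supNorm) hQ.tendsto_supNorm ?_
    filter_upwards [hQ.irreducible, hQ.natDegree, hQ.ne_zero, eventually_lt_of_tendsto_div
      hQ.tendsto_T (tendsto_const_mul_div (v + 1) hQ.height) hQ.value
      ((lt_div_iff₀ hQ.pos_h).1 (by linarith))] with i h1 h2 h3 h4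
    refine ⟨h2.trans_le h2n, norm_pos_iff.2 h3, ?_⟩
    have := le_rpow_neg_of_le_neg_log (one_pos.trans_le (one_le_supNorm h1.ne_zero))
      (norm_pos_iff.2 h3) h4.le
    rwa [neg_add'] at this

end QuadraticApproximations

/-- The quadratic splits as an integer leading coefficient times two linear factors, and that
coefficient has norm at most 1. This keeps the conjugate root away from ξ. -/
theorem norm_aeval_quadratic_le {p : ℕ} [Fact p.Prime] {Q : ℤ[X]} (hd : Q.natDegree = 2)
    {ξ α β : ℚ_[p]} (hα : aeval α Q = 0) (hβ : aeval β Q = 0) (h : α ≠ β) :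
    ‖aeval ξ Q‖ ≤ ‖ξ - α‖ * ‖ξ - β‖ := by
  have hv : ∀ x : ℚ_[p], aeval x Q = Q.coeff 0 + Q.coeff 1 * x + Q.coeff 2 * x ^ 2 := fun x => by
    rw [aeval_eq_sum_range, hd]
    simp [Finset.sum_range_succ]
  rw [hv] at hα hβ
  have h1 : (Q.coeff 1 : ℚ_[p]) + Q.coeff 2 * (α + β) = 0 := by
    have : ((Q.coeff 1 : ℚ_[p]) + Q.coeff 2 * (α + β)) * (α - β) = 0 := by
      linear_combination hα - hβ
    exact (mul_eq_zero.1 this).resolve_right (sub_ne_zero.2 h)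
  have h2 : aeval ξ Q = Q.coeff 2 * ((ξ - α) * (ξ - β)) := by
    rw [hv]
    linear_combination hα + (ξ - α) * h1
  rw [h2, norm_mul, ← norm_mul (ξ - α)]
  exact mul_le_of_le_one_left (norm_nonneg _) (Padic.norm_int_le_one _)

theorem supNorm_eq_of_associated {P Q : ℤ[X]} (h : Associated P Q) : P.supNorm = Q.supNorm := by
  obtain ⟨u, rfl⟩ := h
  obtain ⟨a, ha, hu⟩ := Polynomial.isUnit_iff.1 u.isUnit
  rw [← hu, mul_comm, supNorm_C_mul_int]
  rcases Int.isUnit_iff.1 ha with rfl | rfl <;> simp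

/-- A minimal polynomial not divisible by any late Q_i is not small at ξ, so its roots are not close
to ξ. Otherwise it is ±Q_i, whose roots are α_i and a conjugate. The hypothesis A - B < B says that
the conjugate is the worse approximation. -/
theorem QuadraticApproximations.koksmaExponent_eq {p : ℕ} [Fact p.Prime] {ξ : ℚ_[p]}
    {Q : ℕ → ℤ[X]} {T : ℕ → ℝ} {w h A B : ℝ} {α : ℕ → ℚ_[p]}
    (hQ : QuadraticApproximations ξ Q T w h A) (hroot : ∀ᶠ i in atTop, aeval (α i) (Q i) = 0)
    (hne : ∀ᶠ i in atTop, ξ ≠ α i)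
    (hB : Tendsto (fun i => -Real.log ‖ξ - α i‖ / T i) atTop (𝓝 B)) (hB0 : 0 < B)
    (hAB : A - B < B) {n : ℕ} (h2n : 2 ≤ n)
    (hn : n * h < A) (hE : 2 * (1 + n * h * w / (A - n * h)) < B / h) :
    koksmaExponent p n ξ = ((B / h - 1 : ℝ) : EReal) := by
  refine sSup_coe_image_eq (fun v hv => ?_) fun v hv => ?_
  · by_contra hlt
    obtain ⟨E, hE1, hE2⟩ := exists_between (show B / h < v + 1 by linarith [not_le.1 hlt])
    have hBE : B < E * h := (div_lt_iff₀ hQ.pos_h).1 hE1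
    have hev : ∀ᶠ i in atTop, Irreducible (Q i) ∧ (Q i).natDegree = 2 ∧ aeval ξ (Q i) ≠ 0 ∧
        aeval (α i) (Q i) = 0 ∧ ξ ≠ α i ∧ -Real.log ‖ξ - α i‖ < E * Real.log (Q i).supNorm ∧
        -Real.log ‖aeval ξ (Q i)‖ + Real.log ‖ξ - α i‖ < E * Real.log (Q i).supNorm := by
      have hdiff : Tendsto (fun i => (-Real.log ‖aeval ξ (Q i)‖ + Real.log ‖ξ - α i‖) / T i) atTop
          (𝓝 (A - B)) := by
        refine (hQ.value.sub hB).congr fun i => ?_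
        ring
      filter_upwards [hQ.irreducible, hQ.natDegree, hQ.ne_zero, hroot, hne,
        eventually_lt_of_tendsto_div hQ.tendsto_T hB (tendsto_const_mul_div E hQ.height) hBE,
        eventually_lt_of_tendsto_div hQ.tendsto_T hdiff (tendsto_const_mul_div E hQ.height)
          (hAB.trans hBE)] with i h1 h2 h3 h4 h5 h6 h7
      exact ⟨h1, h2, h3, h4, h5, h6, h7⟩
    obtain ⟨i₀, hi₀⟩ := eventually_atTop.1 hev
    obtain ⟨c, hc, hle⟩ := hQ.dvd_or_le_norm_aeval hn (hE.trans hE1) i₀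
    -- The constant 1 serves the case where the minimal polynomial is ±Q_i, and `c` the other one.
    have hc' : 0 < min c 1 := by positivity
    refine hv (((finite_supNorm_le n ((min c 1)⁻¹ ^ (v + 1 - E)⁻¹)).biUnion
      fun P _ => P.rootSet_finite ℚ_[p]).subset ?_)
    rintro a ⟨P, hP, hPn, ha1, ha2⟩
    have hP0 : P ≠ 0 := hP.irreducible.ne_zero
    have hH1 := one_le_supNorm hP0
    have hH0 : 0 < P.supNorm := one_pos.trans_le hH1
    refine Set.mem_biUnion (x := P) ⟨hPn, ?_⟩ (mem_rootSet.2 ⟨hP0, hP.aeval_eq_zero⟩)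
    have hneg : -v - 1 = -(v + 1) := by ring
    rw [hneg] at ha2
    refine le_rpow_inv_of_mul_rpow_le hc' hH0 hE2 (le_trans ?_ ha2)
    have hv0 : 0 < v + 1 := (div_pos hB0 hQ.pos_h).trans (hE1.trans hE2)
    -- A number this close to ξ is a p-adic integer, as needed to compare |P(ξ)| with |ξ - a|.
    have ha3 : ‖a‖ ≤ 1 := by
      have h1 : ‖ξ - a‖ ≤ 1 := ha2.trans (Real.rpow_le_one_of_one_le_of_nonpos hH1 (by linarith))
      have h2 : a = ξ + -(ξ - a) := by ring
      rw [h2]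
      exact (IsUltrametricDist.norm_add_le_max _ _).trans
        (max_le hQ.norm_le ((norm_neg _).trans_le h1))
    rcases hle P hP0 hPn with ⟨i, hi, hdvd⟩ | hle
    · obtain ⟨h1, h2, h3, h4, h5, h6, h7⟩ := hi₀ i hi
      have hass : Associated (Q i) P := h1.associated_of_dvd hP.irreducible hdvd
      have hsn := supNorm_eq_of_associated hass
      have haQ : aeval a (Q i) = 0 := by
        obtain ⟨r, hr⟩ := hass.symm.dvd
        rw [hr, map_mul, hP.aeval_eq_zero, zero_mul]
      have hone : min c 1 * P.supNorm ^ (-E) ≤ P.supNorm ^ (-E) :=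
        mul_le_of_le_one_left (by positivity) (min_le_right _ _)
      refine hone.trans (rpow_neg_le_of_neg_log_le hH0 ha1 ?_)
      rw [← hsn]
      by_cases haα : α i = a
      · rw [← haα]
        exact h6.le
      · have h8 := norm_aeval_quadratic_le h2 h4 haQ haα (ξ := ξ)
        have h9 := Real.log_le_log (norm_pos_iff.2 h3) h8
        rw [Real.log_mul (norm_ne_zero_iff.2 (sub_ne_zero.2 h5)) ha1.ne'] at h9
        linarith
    · have h1 := norm_aeval_int_sub_le hQ.norm_le ha3 P
      rw [hP.aeval_eq_zero, sub_zero] at h1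
      refine le_trans ?_ (hle.trans h1)
      gcongr
      exact min_le_left _ _
  -- The α_i form an infinite set because their distances to ξ tend to 0 without vanishing.
  · refine infinite_of_tendsto_atTop (fun a => -Real.log ‖ξ - a‖) (x := α) ?_ ?_
    · refine (hB.pos_mul_atTop hB0 hQ.tendsto_T).congr' ?_
      filter_upwards [hQ.tendsto_T.eventually_gt_atTop 0] with i hi
      field_simp
    filter_upwards [hQ.irreducible, hQ.natDegree, hroot, hne, eventually_lt_of_tendsto_div
      hQ.tendsto_T (tendsto_const_mul_div (v + 1) hQ.height) hB
      ((lt_div_iff₀ hQ.pos_h).1 (by linarith))] with i h1 h2 h3 h4 h5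
    have hpos : 0 < ‖ξ - α i‖ := norm_pos_iff.2 (sub_ne_zero.2 h4)
    have hle := le_rpow_neg_of_le_neg_log (one_pos.trans_le (one_le_supNorm h1.ne_zero)) hpos h5.le
    rw [neg_add'] at hle
    -- `Q i` is only known up to sign, while a minimal polynomial has positive leading coefficient.
    rcases lt_or_gt_of_ne (leadingCoeff_ne_zero.2 h1.ne_zero) with hl | hl
    · have hneg : Irreducible (-Q i) := (Associated.neg_left (Associated.refl _)).symm.irreducible h1
      refine ⟨-Q i, ⟨by rw [natDegree_neg]; omega, hneg, ?_, by simpa using hl, by simpa using h3⟩,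
        by rw [natDegree_neg]; omega, hpos, by rwa [supNorm_neg_int]⟩
      exact hneg.isPrimitive (by rw [natDegree_neg]; omega)
    · exact ⟨Q i, ⟨by omega, h1, h1.isPrimitive (by omega), hl, h3⟩, by omega, hpos, hle⟩

/-! ### The matrices of a Schneider continued fraction -/

/-- The matrix `[[p_(n-1), p_n], [q_(n-1), q_n]]` of the convergents of a Schneider continued
fraction. -/
def schneiderMatrix (p : ℕ) (a : ℕ → ℕ) : ℕ → Matrix (Fin 2) (Fin 2) ℤ
  | 0 => 1
  | n + 1 => schneiderMatrix p a n * !![0, (p : ℤ) ^ a n; 1, 1]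

section
variable (p : ℕ) (a : ℕ → ℕ)

theorem schneiderMatrix_succ_zero (n : ℕ) (i : Fin 2) :
    schneiderMatrix p a (n + 1) i 0 = schneiderMatrix p a n i 1 := by
  simp [schneiderMatrix, Matrix.mul_apply]

theorem schneiderMatrix_succ_one (n : ℕ) (i : Fin 2) :
    schneiderMatrix p a (n + 1) i 1
      = schneiderMatrix p a n i 1 + (p : ℤ) ^ a n * schneiderMatrix p a n i 0 := by
  simp [schneiderMatrix, Matrix.mul_apply]
  ring

theorem schneiderMatrix_add (m n : ℕ) :
    schneiderMatrix p a (m + n) = schneiderMatrix p a m * schneiderMatrix p (fun k => a (m + k)) n := by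
  induction n with
  | zero => simp [schneiderMatrix]
  | succ n ih => rw [← add_assoc, schneiderMatrix, ih, schneiderMatrix, Matrix.mul_assoc]

theorem schneiderMatrix_congr {a b : ℕ → ℕ} {n : ℕ} (h : ∀ k < n, a k = b k) :
    schneiderMatrix p a n = schneiderMatrix p b n := by
  induction n with
  | zero => rfl
  | succ n ih =>
    rw [schneiderMatrix, schneiderMatrix, ih fun k hk => h k (by omega), h n (by omega)]

theorem det_schneiderMatrix (n : ℕ) :
    (schneiderMatrix p a n).det = (-1) ^ n * (p : ℤ) ^ ∑ k ∈ Finset.range n, a k := by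
  induction n with
  | zero => simp [schneiderMatrix]
  | succ n ih =>
    rw [schneiderMatrix, Matrix.det_mul, ih, Finset.sum_range_succ, Matrix.det_fin_two]
    simp
    ring

theorem det_schneiderMatrix_sq (n : ℕ) :
    (schneiderMatrix p a n).det ^ 2 = (p : ℤ) ^ (2 * ∑ k ∈ Finset.range n, a k) := by
  rw [det_schneiderMatrix, mul_pow, ← pow_mul, mul_comm n, pow_mul]
  simp [← pow_mul, mul_comm]

theorem schneiderMatrix_nonneg (n : ℕ) (i j : Fin 2) : 0 ≤ schneiderMatrix p a n i j := by
  induction n generalizing j with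
  | zero => fin_cases i <;> fin_cases j <;> simp [schneiderMatrix]
  | succ n ih =>
    fin_cases j
    · exact (schneiderMatrix_succ_zero p a n i).symm ▸ ih 1
    · refine (schneiderMatrix_succ_one p a n i).symm ▸ ?_
      have := ih 0
      have := ih 1
      positivity

theorem schneiderMatrix_zero_le_one {n : ℕ} (hn : 0 < n) (i : Fin 2) :
    schneiderMatrix p a n i 0 ≤ schneiderMatrix p a n i 1 := by
  obtain ⟨n, rfl⟩ : ∃ m, n = m + 1 := ⟨n - 1, by omega⟩
  rw [schneiderMatrix_succ_zero, schneiderMatrix_succ_one]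
  have := schneiderMatrix_nonneg p a n i 0
  linarith [show 0 ≤ (p : ℤ) ^ a n * schneiderMatrix p a n i 0 by positivity]

variable {a}

/-- Modulo p every factor is !![0, 0; 1, 1], so numerators of convergents vanish and, as the next
lemma says, denominators are 1. -/
theorem dvd_schneiderMatrix (ha : ∀ k, 0 < a k) (n : ℕ) :
    (p : ℤ) ∣ schneiderMatrix p a n 0 1 ∧ (p : ℤ) ∣ schneiderMatrix p a (n + 1) 0 0 := by
  rw [schneiderMatrix_succ_zero, and_self]
  induction n with
  | zero => simp [schneiderMatrix]
  | succ n ih =>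
    rw [schneiderMatrix_succ_one]
    exact dvd_add ih (dvd_mul_of_dvd_left (dvd_pow_self _ (ha n).ne') _)

theorem dvd_schneiderMatrix_sub_one (ha : ∀ k, 0 < a k) (n : ℕ) :
    (p : ℤ) ∣ schneiderMatrix p a n 1 1 - 1 := by
  induction n with
  | zero => simp [schneiderMatrix]
  | succ n ih =>
    rw [schneiderMatrix_succ_one, add_sub_right_comm]
    exact dvd_add ih (dvd_mul_of_dvd_left (dvd_pow_self _ (ha n).ne') _)

/-- Powers of J = !![0, p^e; 1, 1] are combinations of the identity and J. -/
theorem schneiderMatrix_const (e n : ℕ) :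
    schneiderMatrix p (fun _ => e) n 0 1 = p ^ e * schneiderMatrix p (fun _ => e) n 1 0 ∧
    schneiderMatrix p (fun _ => e) n 1 1
      = schneiderMatrix p (fun _ => e) n 0 0 + schneiderMatrix p (fun _ => e) n 1 0 := by
  induction n with
  | zero => simp [schneiderMatrix]
  | succ n ih =>
    rw [schneiderMatrix_succ_zero, schneiderMatrix_succ_zero, schneiderMatrix_succ_one,
      schneiderMatrix_succ_one]
    obtain ⟨h1, h2⟩ := ih
    constructor
    · linear_combination h1 - p ^ e * h2
    · linear_combination -h1

end

theorem norm_intCast_eq_one_of_dvd_sub {p : ℕ} [hp : Fact p.Prime] {z : ℤ} (hz : (p : ℤ) ∣ z - 1) :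
    ‖(z : ℚ_[p])‖ = 1 := by
  have h : ¬ (p : ℤ) ∣ z := fun h => by
    have h1 : (p : ℤ) ∣ 1 := by simpa using dvd_sub h hz
    exact (Nat.prime_iff_prime_int.1 hp.out).not_dvd_one h1
  exact le_antisymm (Padic.norm_int_le_one z)
    (not_lt.1 fun h' => h ((Padic.norm_intCast_lt_one_iff).1 h'))

/-! ### Growth of the matrix entries -/

section
variable {p : ℕ} {a : ℕ → ℕ}

/-- Heuristically u_n² has size p^(a_0 + ⋯ + a_(n-1)), since each step of two indices multiplies u
by about p^(a_(n+1)). The variation bound 7 replaces 2a_(n+1) by a_n + a_(n+1), and a factor p² ≥ 4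
absorbs the sum of two terms; 9 per index covers both losses. -/
theorem sq_le_pow_of_recurrence (hp : 2 ≤ p) (ha : ∀ k, a (k + 1) ≤ a k + 7) {u : ℕ → ℤ}
    (hu : ∀ n, u (n + 2) = u (n + 1) + (p : ℤ) ^ a (n + 1) * u n) {c : ℕ}
    (h0 : u 0 ^ 2 ≤ (p : ℤ) ^ c) (h1 : u 1 ^ 2 ≤ (p : ℤ) ^ (a 0 + 9 + c)) (n : ℕ) :
    u n ^ 2 ≤ (p : ℤ) ^ (∑ k ∈ Finset.range n, a k + 9 * n + c) := by
  have hp1 : (1 : ℤ) ≤ p := by exact_mod_cast (by omega : 1 ≤ p)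
  suffices h : u n ^ 2 ≤ (p : ℤ) ^ (∑ k ∈ Finset.range n, a k + 9 * n + c) ∧
      u (n + 1) ^ 2 ≤ (p : ℤ) ^ (∑ k ∈ Finset.range (n + 1), a k + 9 * (n + 1) + c) from h.1
  induction n with
  | zero => exact ⟨by simpa using h0, by simpa using h1⟩
  | succ n ih =>
    obtain ⟨ih0, ih1⟩ := ih
    refine ⟨ih1, ?_⟩
    rw [add_assoc n 1 1, hu]
    set E := ∑ k ∈ Finset.range (n + (1 + 1)), a k + 9 * (n + (1 + 1)) + c with hE
    have hs2 : ∑ k ∈ Finset.range (n + (1 + 1)), a k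
        = ∑ k ∈ Finset.range n, a k + a n + a (n + 1) := by
      rw [show n + (1 + 1) = n + 1 + 1 by ring, Finset.sum_range_succ, Finset.sum_range_succ]
    have hs1 : ∑ k ∈ Finset.range (n + 1), a k = ∑ k ∈ Finset.range n, a k + a n :=
      Finset.sum_range_succ _ _
    have han := ha n
    have e1 : u (n + 1) ^ 2 ≤ (p : ℤ) ^ (E - 2) :=
      ih1.trans (pow_le_pow_right₀ hp1 (by omega))
    have e2 : ((p : ℤ) ^ a (n + 1) * u n) ^ 2 ≤ (p : ℤ) ^ (E - 2) := by
      rw [mul_pow, ← pow_mul]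
      calc (p : ℤ) ^ (a (n + 1) * 2) * u n ^ 2
          ≤ (p : ℤ) ^ (a (n + 1) * 2) * (p : ℤ) ^ (∑ k ∈ Finset.range n, a k + 9 * n + c) := by
            gcongr
        _ ≤ _ := by
          rw [← pow_add]
          exact pow_le_pow_right₀ hp1 (by omega)
    have e3 : 4 * (p : ℤ) ^ (E - 2) ≤ (p : ℤ) ^ E := by
      have h4 : (4 : ℤ) ≤ p ^ 2 := by
        have : (2 : ℤ) ≤ p := by exact_mod_cast hp
        nlinarith
      calc 4 * (p : ℤ) ^ (E - 2) ≤ p ^ 2 * (p : ℤ) ^ (E - 2) := by gcongr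
        _ = (p : ℤ) ^ E := by
          rw [← pow_add]
          congr 1
          omega
    nlinarith [sq_nonneg (u (n + 1) - (p : ℤ) ^ a (n + 1) * u n)]

/-- Here the positive term u_(n+1) of the recurrence is dropped, so only the variation 7 of the
exponents is lost. -/
theorem pow_le_sq_of_recurrence (hp : 2 ≤ p) (ha : ∀ k, a k ≤ a (k + 1) + 7) {u : ℕ → ℤ}
    (hu : ∀ n, u (n + 2) = u (n + 1) + (p : ℤ) ^ a (n + 1) * u n) (hu0 : ∀ n, 0 ≤ u n) {c : ℕ}
    (h1 : (p : ℤ) ^ a 0 ≤ u 1 ^ 2 * (p : ℤ) ^ (7 + c))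
    (h2 : (p : ℤ) ^ (a 0 + a 1) ≤ u 2 ^ 2 * (p : ℤ) ^ (14 + c)) (n : ℕ) :
    (p : ℤ) ^ (∑ k ∈ Finset.range (n + 1), a k) ≤ u (n + 1) ^ 2 * (p : ℤ) ^ (7 * (n + 1) + c) := by
  have hp1 : (1 : ℤ) ≤ p := by exact_mod_cast (by omega : 1 ≤ p)
  suffices h : ∀ n, (p : ℤ) ^ (∑ k ∈ Finset.range (n + 1), a k)
        ≤ u (n + 1) ^ 2 * (p : ℤ) ^ (7 * (n + 1) + c) ∧
      (p : ℤ) ^ (∑ k ∈ Finset.range (n + 2), a k)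
        ≤ u (n + 2) ^ 2 * (p : ℤ) ^ (7 * (n + 2) + c) from (h n).1
  intro n
  induction n with
  | zero => exact ⟨by simpa using h1, by simpa [Finset.sum_range_succ] using h2⟩
  | succ n ih =>
    obtain ⟨ih0, ih1⟩ := ih
    refine ⟨ih1, ?_⟩
    have hs : ∑ k ∈ Finset.range (n + 1 + 2), a k
        = ∑ k ∈ Finset.range (n + 1), a k + a (n + 1) + a (n + 2) := by
      rw [Finset.sum_range_succ, Finset.sum_range_succ]
    have han : a (n + 1) ≤ a (n + 2) + 7 := ha (n + 1)
    have e1 : ((p : ℤ) ^ a (n + 2) * u (n + 1)) ^ 2 ≤ u (n + 1 + 2) ^ 2 := by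
      have h3 := hu0 (n + 1)
      have h4 := hu0 (n + 1 + 1)
      refine pow_le_pow_left₀ (by positivity) ?_ 2
      rw [hu (n + 1)]
      linarith
    calc (p : ℤ) ^ (∑ k ∈ Finset.range (n + 1 + 2), a k)
        ≤ (p : ℤ) ^ (2 * a (n + 2) + 7 + ∑ k ∈ Finset.range (n + 1), a k) :=
          pow_le_pow_right₀ hp1 (by rw [hs]; omega)
      _ = (p : ℤ) ^ (2 * a (n + 2) + 7) * (p : ℤ) ^ ∑ k ∈ Finset.range (n + 1), a k := pow_add _ _ _
      _ ≤ (p : ℤ) ^ (2 * a (n + 2) + 7) * (u (n + 1) ^ 2 * (p : ℤ) ^ (7 * (n + 1) + c)) := by gcongr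
      _ = ((p : ℤ) ^ a (n + 2) * u (n + 1)) ^ 2 * (p : ℤ) ^ (7 + (7 * (n + 1) + c)) := by ring
      _ ≤ u (n + 1 + 2) ^ 2 * (p : ℤ) ^ (7 * (n + 1 + 2) + c) := by
          exact mul_le_mul e1 (pow_le_pow_right₀ hp1 (by omega)) (by positivity) (by positivity)

theorem schneiderMatrix_recurrence (i : Fin 2) (n : ℕ) :
    schneiderMatrix p a (n + 2) i 1 = schneiderMatrix p a (n + 1) i 1
      + (p : ℤ) ^ a (n + 1) * schneiderMatrix p a n i 1 := by
  rw [schneiderMatrix_succ_one, schneiderMatrix_succ_zero]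

theorem schneiderMatrix_one_sq_le (hp : 2 ≤ p) (ha : ∀ k, a (k + 1) ≤ a k + 7) (n : ℕ)
    (i : Fin 2) :
    schneiderMatrix p a n i 1 ^ 2 ≤ (p : ℤ) ^ (∑ k ∈ Finset.range n, a k + 9 * n + a 0) := by
  have hp1 : (1 : ℤ) ≤ p := by exact_mod_cast (by omega : 1 ≤ p)
  refine sq_le_pow_of_recurrence (u := fun n => schneiderMatrix p a n i 1) hp ha
    (schneiderMatrix_recurrence i) ?_ ?_ n
  · have h := one_le_pow₀ hp1 (n := a 0)
    fin_cases i
    · simp [schneiderMatrix]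
    · change (1 : Matrix (Fin 2) (Fin 2) ℤ) 1 1 ^ 2 ≤ _
      rwa [Matrix.one_apply_eq, one_pow]
  · fin_cases i
    · simp only [schneiderMatrix, Matrix.one_mul]
      simp only [Fin.zero_eta, Matrix.of_apply, Matrix.cons_val', Matrix.cons_val_one,
        Matrix.cons_val_zero, Matrix.cons_val_fin_one, ← pow_mul]
      exact pow_le_pow_right₀ hp1 (by omega)
    · have h := one_le_pow₀ hp1 (n := a 0 + 9 + a 0)
      simpa [schneiderMatrix] using h

theorem schneiderMatrix_sq_le (hp : 2 ≤ p) (ha : ∀ k, a (k + 1) ≤ a k + 7) {n : ℕ} (hn : 0 < n)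
    (i j : Fin 2) :
    schneiderMatrix p a n i j ^ 2 ≤ (p : ℤ) ^ (∑ k ∈ Finset.range n, a k + 9 * n + a 0) := by
  refine le_trans ?_ (schneiderMatrix_one_sq_le hp ha n i)
  refine pow_le_pow_left₀ (schneiderMatrix_nonneg p a n i j) ?_ 2
  fin_cases j
  · exact schneiderMatrix_zero_le_one p a hn i
  · exact le_rfl

theorem pow_le_schneiderMatrix_sq (hp : 2 ≤ p) (ha : ∀ k, a (k + 1) ≤ a k + 7)
    (ha' : ∀ k, a k ≤ a (k + 1) + 7) {n : ℕ} (hn : 0 < n) (i : Fin 2) :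
    (p : ℤ) ^ (∑ k ∈ Finset.range n, a k)
      ≤ schneiderMatrix p a n i 1 ^ 2 * (p : ℤ) ^ (7 * n + 2 * a 0) := by
  have hp1 : (1 : ℤ) ≤ p := by exact_mod_cast (by omega : 1 ≤ p)
  obtain ⟨n, rfl⟩ : ∃ m, n = m + 1 := ⟨n - 1, by omega⟩
  have ha0 : a 1 ≤ a 0 + 7 := ha 0
  have h1 : 1 ≤ schneiderMatrix p a 1 i 1 := by
    have h := one_le_pow₀ hp1 (n := a 0)
    fin_cases i <;> simp [schneiderMatrix, h]
  have h2 : 1 ≤ schneiderMatrix p a 2 i 1 := by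
    rw [schneiderMatrix_recurrence]
    have := schneiderMatrix_nonneg p a 0 i 1
    linarith [show 0 ≤ (p : ℤ) ^ a (0 + 1) * schneiderMatrix p a 0 i 1 by positivity]
  refine pow_le_sq_of_recurrence (u := fun n => schneiderMatrix p a n i 1) hp ha'
    (schneiderMatrix_recurrence i) (fun n => schneiderMatrix_nonneg p a n i 1) ?_ ?_ n
  · calc (p : ℤ) ^ a 0 ≤ 1 ^ 2 * (p : ℤ) ^ (7 + 2 * a 0) := by
          rw [one_pow, one_mul]
          exact pow_le_pow_right₀ hp1 (by omega)
      _ ≤ _ := by gcongr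
  · calc (p : ℤ) ^ (a 0 + a 1) ≤ 1 ^ 2 * (p : ℤ) ^ (14 + 2 * a 0) := by
          rw [one_pow, one_mul]
          exact pow_le_pow_right₀ hp1 (by omega)
      _ ≤ _ := by gcongr

end

/-! ### Quadratic polynomials attached to matrices -/

/-- The polynomial whose roots are the fixed points of the homography attached to `G`. -/
noncomputable def fixedPointPoly (G : Matrix (Fin 2) (Fin 2) ℤ) : ℤ[X] :=
  C (G 1 0) * X ^ 2 + C (G 1 1 - G 0 0) * X + C (-G 0 1)

theorem coeff_quadratic_int (a b c : ℤ) : (C a * X ^ 2 + C b * X + C c).coeff 2 = a ∧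
    (C a * X ^ 2 + C b * X + C c).coeff 1 = b ∧ (C a * X ^ 2 + C b * X + C c).coeff 0 = c := by
  simp only [coeff_add, coeff_C_mul, coeff_X_pow, coeff_X, coeff_C]
  norm_num

section
variable (G R N : Matrix (Fin 2) (Fin 2) ℤ)

theorem coeff_fixedPointPoly : (fixedPointPoly G).coeff 2 = G 1 0 ∧
    (fixedPointPoly G).coeff 1 = G 1 1 - G 0 0 ∧ (fixedPointPoly G).coeff 0 = -G 0 1 :=
  coeff_quadratic_int _ _ _

theorem aeval_fixedPointPoly {K : Type*} [CommRing K] (x : K) :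
    aeval x (fixedPointPoly G) = G 1 0 * x ^ 2 + (G 1 1 - G 0 0) * x - G 0 1 := by
  simp [fixedPointPoly]
  ring

theorem natDegree_fixedPointPoly_le : (fixedPointPoly G).natDegree ≤ 2 := natDegree_quadratic_le

theorem natDegree_fixedPointPoly {G : Matrix (Fin 2) (Fin 2) ℤ} (h : G 1 0 ≠ 0) :
    (fixedPointPoly G).natDegree = 2 := natDegree_quadratic h

theorem conj_fin_two : (R * N * R.adjugate) =
    !![(R 0 0 * N 0 0 + R 0 1 * N 1 0) * R 1 1 - (R 0 0 * N 0 1 + R 0 1 * N 1 1) * R 1 0,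
      (R 0 0 * N 0 1 + R 0 1 * N 1 1) * R 0 0 - (R 0 0 * N 0 0 + R 0 1 * N 1 0) * R 0 1;
      (R 1 0 * N 0 0 + R 1 1 * N 1 0) * R 1 1 - (R 1 0 * N 0 1 + R 1 1 * N 1 1) * R 1 0,
      (R 1 0 * N 0 1 + R 1 1 * N 1 1) * R 0 0 - (R 1 0 * N 0 0 + R 1 1 * N 1 0) * R 0 1] := by
  ext i j
  fin_cases i <;> fin_cases j <;>
    simp [Matrix.mul_apply, Fin.sum_univ_two, Matrix.adjugate_fin_two] <;> ring

/-- Since R N adj(R) = det(R) · R N R⁻¹, its fixed points are the images under R of those of N. This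
is the transformation law of the binary quadratic form, without division. -/
theorem sq_mul_aeval_fixedPointPoly_conj {K : Type*} [CommRing K] {x y : K}
    (h : y * (R 1 0 * x + R 1 1) = R 0 0 * x + R 0 1) :
    (R 1 0 * x + R 1 1) ^ 2 * aeval y (fixedPointPoly (R * N * R.adjugate))
      = (R.det : K) ^ 2 * aeval x (fixedPointPoly N) := by
  rw [aeval_fixedPointPoly, aeval_fixedPointPoly, Matrix.det_fin_two]
  set G := R * N * R.adjugate with hG
  have h1 : (R 1 0 * x + R 1 1) ^ 2 * (G 1 0 * y ^ 2 + (G 1 1 - G 0 0) * y - G 0 1)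
      = G 1 0 * (R 0 0 * x + R 0 1) ^ 2 + (G 1 1 - G 0 0) * (R 0 0 * x + R 0 1)
        * (R 1 0 * x + R 1 1) - G 0 1 * (R 1 0 * x + R 1 1) ^ 2 := by
    rw [← h]
    ring
  rw [h1, hG, conj_fin_two]
  simp
  ring

/-- If x = N·y, the fixed-point polynomial at x measures how far y is from x. For a continued
fraction, x and y are two complete quotients one period apart. -/
theorem mul_aeval_fixedPointPoly {K : Type*} [CommRing K] {x y : K}
    (h : x * (N 1 0 * y + N 1 1) = N 0 0 * y + N 0 1) :
    (N 1 0 * y + N 1 1) * aeval x (fixedPointPoly N) = (N.det : K) * (y - x) := by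
  rw [aeval_fixedPointPoly, Matrix.det_fin_two]
  push_cast
  linear_combination (N 1 0 * x + N 1 1) * h

theorem discrim_fixedPointPoly_conj :
    (fixedPointPoly (R * N * R.adjugate)).coeff 1 ^ 2
      - 4 * (fixedPointPoly (R * N * R.adjugate)).coeff 2
        * (fixedPointPoly (R * N * R.adjugate)).coeff 0
      = R.det ^ 2 * (N.trace ^ 2 - 4 * N.det) := by
  obtain ⟨h2, h1, h0⟩ := coeff_fixedPointPoly (R * N * R.adjugate)
  rw [h2, h1, h0, conj_fin_two, Matrix.det_fin_two, Matrix.det_fin_two, Matrix.trace_fin_two]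
  simp
  ring

/-- Substituting back through R recovers det(R)² times the form of N as an integral combination of
the coefficients. -/
theorem dvd_of_dvd_fixedPointPoly_conj {g : ℤ}
    (h : ∀ i, g ∣ (fixedPointPoly (R * N * R.adjugate)).coeff i) :
    g ∣ R.det ^ 2 * N 1 0 ∧ g ∣ R.det ^ 2 * (N 1 1 - N 0 0) := by
  obtain ⟨h2, h1, h0⟩ := coeff_fixedPointPoly (R * N * R.adjugate)
  have g2 := h 2
  have g1 := h 1
  have g0 := h 0
  rw [h2] at g2
  rw [h1] at g1
  rw [h0] at g0
  set G := R * N * R.adjugate with hG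
  have e1 : R.det ^ 2 * N 1 0 = G 1 0 * R 0 0 ^ 2 + (G 1 1 - G 0 0) * (R 0 0 * R 1 0)
      + -G 0 1 * R 1 0 ^ 2 := by
    rw [hG, conj_fin_two, Matrix.det_fin_two]
    simp
    ring
  have e2 : R.det ^ 2 * (N 1 1 - N 0 0) = G 1 0 * (2 * R 0 0 * R 0 1)
      + (G 1 1 - G 0 0) * (R 0 0 * R 1 1 + R 0 1 * R 1 0) + -G 0 1 * (2 * R 1 0 * R 1 1) := by
    rw [hG, conj_fin_two, Matrix.det_fin_two]
    simp
    ring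
  rw [e1, e2]
  exact ⟨((g2.mul_right _).add (g1.mul_right _)).add (g0.mul_right _),
    ((g2.mul_right _).add (g1.mul_right _)).add (g0.mul_right _)⟩

end

/-! ### Irreducibility of quadratics via the discriminant -/

theorem irreducible_of_not_isSquare_discrim {P : ℤ[X]} (hP : P.IsPrimitive) (hd : P.natDegree = 2)
    (h : ¬ IsSquare (P.coeff 1 ^ 2 - 4 * P.coeff 2 * P.coeff 0)) : Irreducible P := by
  have hunit : ∀ A B : ℤ[X], P = A * B → A.natDegree = 0 → IsUnit A := fun A B hAB hA => by
    rw [eq_C_of_natDegree_eq_zero hA] at hAB ⊢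
    exact isUnit_C.2 (hP _ ⟨B, hAB⟩)
  refine ⟨fun hu => ?_, fun A B hAB => ?_⟩
  · have := natDegree_eq_zero_of_isUnit hu
    omega
  by_contra! hcon
  have hA := mt (hunit A B hAB) hcon.1
  have hB := mt (hunit B A (hAB.trans (mul_comm _ _))) hcon.2
  have hP0 := hP.ne_zero
  rw [hAB] at hP0
  have hdeg := natDegree_mul (left_ne_zero_of_mul hP0) (right_ne_zero_of_mul hP0)
  rw [← hAB, hd] at hdeg
  have hA1 := eq_X_add_C_of_natDegree_le_one (show A.natDegree ≤ 1 by omega)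
  have hB1 := eq_X_add_C_of_natDegree_le_one (show B.natDegree ≤ 1 by omega)
  have e : P = C (A.coeff 1 * B.coeff 1) * X ^ 2
      + C (A.coeff 1 * B.coeff 0 + A.coeff 0 * B.coeff 1) * X + C (A.coeff 0 * B.coeff 0) := by
    rw [C_mul, C_add, C_mul, C_mul, C_mul, hAB]
    conv_lhs => rw [hA1, hB1]
    ring
  refine h ⟨A.coeff 1 * B.coeff 0 - A.coeff 0 * B.coeff 1, ?_⟩
  obtain ⟨h2, h1, h0⟩ := coeff_quadratic_int (A.coeff 1 * B.coeff 1)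
    (A.coeff 1 * B.coeff 0 + A.coeff 0 * B.coeff 1) (A.coeff 0 * B.coeff 0)
  rw [← e] at h2 h1 h0
  rw [h2, h1, h0]
  ring

/-- If t² - 4D = k², then D = lm with l, m = (t ∓ k)/2 and l + m = t. As D is ± a power of p and p
does not divide t, one of l, m is ±1, which forces |t| ≥ p^S - 1. -/
theorem not_isSquare_sq_sub {p S : ℕ} (hp : p.Prime) {t D : ℤ} (hD : D.natAbs = p ^ S)
    (ht : ¬ (p : ℤ) ∣ t) (hlt : |t| < (p : ℤ) ^ S - 1) : ¬ IsSquare (t ^ 2 - 4 * D) := by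
  rintro ⟨k, hk⟩
  have hev : Even (t - k) := by
    by_contra h
    have h1 : Odd (t - k) := Int.not_even_iff_odd.1 h
    have h2 : Odd (t + k) := by
      have : t + k = t - k + 2 * k := by ring
      rw [this]
      exact h1.add_even (even_two_mul k)
    have h3 : Even ((t - k) * (t + k)) := ⟨2 * D, by linear_combination hk⟩
    exact (Int.not_even_iff_odd.2 (h1.mul h2)) h3
  obtain ⟨l, hl⟩ := hev
  obtain ⟨m, rfl⟩ : ∃ m, t = l + m := ⟨t - l, by ring⟩
  obtain rfl : k = m - l := by linarith
  have hlm : l * m = D := by linarith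
  have hnat : l.natAbs * m.natAbs = p ^ S := by rw [← Int.natAbs_mul, hlm, hD]
  obtain ⟨i, -, hi⟩ := (Nat.dvd_prime_pow hp).1 (Dvd.intro _ hnat)
  obtain ⟨j, -, hj⟩ := (Nat.dvd_prime_pow hp).1 (Dvd.intro_left _ hnat)
  have hij : i = 0 ∨ j = 0 := by
    by_contra! h
    refine ht (dvd_add ?_ ?_)
    · exact Int.natCast_dvd.2 (hi ▸ dvd_pow_self p h.1)
    · exact Int.natCast_dvd.2 (hj ▸ dvd_pow_self p h.2)
  have hl' : |l| = (p : ℤ) ^ i := by rw [Int.abs_eq_natAbs, hi]; push_cast; rfl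
  have hm' : |m| = (p : ℤ) ^ j := by rw [Int.abs_eq_natAbs, hj]; push_cast; rfl
  have hprod : |l| * |m| = (p : ℤ) ^ S := by
    rw [Int.abs_eq_natAbs, Int.abs_eq_natAbs]; exact_mod_cast hnat
  have h1 : |l| ≤ |l + m| + |m| := by
    have := abs_sub (l + m) m
    simpa using this
  have h2 : |m| ≤ |l + m| + |l| := by
    have := abs_sub (l + m) l
    simpa using this
  rcases hij with rfl | rfl
  · rw [pow_zero] at hl'
    rw [hl'] at hprod h2
    linarith
  · rw [pow_zero] at hm'
    rw [hm'] at hprod h1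
    linarith

/-! ### Values of Schneider continued fractions -/

section
variable {p : ℕ} [hp : Fact p.Prime] {a : ℕ → ℕ}

theorem norm_schneiderCF (ha : ∀ k, 0 < a k) : ‖schneiderCF p a‖ = (p : ℝ)⁻¹ ^ a 0 := by
  have h1 := ((tendsto_schneiderConvergent p a ha).comp (tendsto_add_atTop_nat 1)).norm
  refine tendsto_nhds_unique h1 (tendsto_const_nhds.congr fun n => ?_)
  simp only [Function.comp_apply, schneiderConvergent]
  rw [norm_div, norm_one_add_of_norm_lt_one (norm_schneiderConvergent_lt_one p n _ fun k => ha _),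
    norm_pow, Padic.norm_p, div_one]

theorem norm_schneiderCF_lt_one (ha : ∀ k, 0 < a k) : ‖schneiderCF p a‖ < 1 := by
  rw [norm_schneiderCF ha]
  exact pow_lt_one₀ (by positivity) (inv_lt_one_of_one_lt₀ (by exact_mod_cast hp.out.one_lt))
    (ha 0).ne'

theorem schneiderCF_mul (ha : ∀ k, 0 < a k) :
    schneiderCF p a * (1 + schneiderCF p fun k => a (k + 1)) = (p : ℚ_[p]) ^ a 0 := by
  have ht := tendsto_schneiderConvergent p (fun k => a (k + 1)) fun k => ha _
  have h1 := (((tendsto_schneiderConvergent p a ha).comp (tendsto_add_atTop_nat 1))).mul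
    (ht.const_add 1)
  refine tendsto_nhds_unique h1 (tendsto_const_nhds.congr fun n => ?_)
  simp only [Function.comp_apply, schneiderConvergent]
  have h := norm_one_add_of_norm_lt_one (norm_schneiderConvergent_lt_one p n
    (fun k => a (k + 1)) fun k => ha _)
  rw [div_mul_cancel₀]
  intro h0
  simp [h0] at h

/-- The continued fraction is the image of its complete quotient under the homography given by
the matrix of the convergents. -/
theorem schneiderCF_mul_eq (ha : ∀ k, 0 < a k) (n : ℕ) :
    schneiderCF p a * (schneiderMatrix p a n 1 0 * schneiderCF p (fun k => a (n + k))
        + schneiderMatrix p a n 1 1)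
      = schneiderMatrix p a n 0 0 * schneiderCF p (fun k => a (n + k))
        + schneiderMatrix p a n 0 1 := by
  induction n with
  | zero => simp [schneiderMatrix]
  | succ n ih =>
    have h := schneiderCF_mul (p := p) (a := fun k => a (n + k)) fun k => ha _
    simp only [add_zero] at h
    have e : (fun k => a (n + 1 + k)) = fun k => a (n + (k + 1)) := by
      funext k
      congr 1
      ring
    rw [e, schneiderMatrix_succ_zero, schneiderMatrix_succ_zero, schneiderMatrix_succ_one,
      schneiderMatrix_succ_one]
    push_cast
    rw [← h]
    linear_combination (1 + schneiderCF p fun k => a (n + (k + 1))) * ih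

theorem norm_schneiderMatrix_mul_add (ha : ∀ k, 0 < a k) (n : ℕ) {x : ℚ_[p]} (hx : ‖x‖ < 1) :
    ‖(schneiderMatrix p a n 1 0 : ℚ_[p]) * x + schneiderMatrix p a n 1 1‖ = 1 := by
  have h1 : ‖(schneiderMatrix p a n 1 1 : ℚ_[p])‖ = 1 :=
    norm_intCast_eq_one_of_dvd_sub (dvd_schneiderMatrix_sub_one p ha n)
  have h2 : ‖(schneiderMatrix p a n 1 0 : ℚ_[p]) * x‖ < 1 := by
    rw [norm_mul]
    exact (mul_le_of_le_one_left (norm_nonneg _) (Padic.norm_int_le_one _)).trans_lt hx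
  rw [IsUltrametricDist.norm_add_eq_max_of_norm_ne_norm (by rw [h1]; exact h2.ne), h1,
    max_eq_right h2.le]

/-- From x(1+x') = y(1+y') one gets (x-y)(1+x') = -y(x'-y'), with 1+x' a unit: each common exponent
contributes |y|. At the first disagreement the smaller exponent has the larger norm and decides. -/
theorem norm_schneiderCF_sub {b : ℕ → ℕ} (ha : ∀ k, 0 < a k) (hb : ∀ k, 0 < b k) {n : ℕ}
    (h : ∀ k < n, a k = b k) (hn : b n < a n) :
    ‖schneiderCF p a - schneiderCF p b‖ = (p : ℝ)⁻¹ ^ (∑ k ∈ Finset.range n, b k + b n) := by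
  induction n generalizing a b with
  | zero =>
    have hlt : ‖schneiderCF p a‖ < ‖schneiderCF p b‖ := by
      rw [norm_schneiderCF ha, norm_schneiderCF hb]
      exact pow_lt_pow_right_of_lt_one₀ (by have := hp.out.pos; positivity)
        (inv_lt_one_of_one_lt₀ (by exact_mod_cast hp.out.one_lt)) hn
    rw [sub_eq_add_neg, IsUltrametricDist.norm_add_eq_max_of_norm_ne_norm
      (by rw [norm_neg]; exact hlt.ne), norm_neg, max_eq_right hlt.le, norm_schneiderCF hb]
    simp
  | succ n ih =>
    have ih' := ih (a := fun k => a (k + 1)) (b := fun k => b (k + 1)) (fun k => ha _)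
      (fun k => hb _) (fun k hk => h _ (by omega)) hn
    have h1 := schneiderCF_mul (p := p) ha
    have h2 := schneiderCF_mul (p := p) hb
    have n1 := norm_one_add_of_norm_lt_one (norm_schneiderCF_lt_one (p := p)
      (a := fun k => a (k + 1)) fun k => ha _)
    have n2 := norm_schneiderCF (p := p) hb
    rw [h 0 (by omega), ← h2] at h1
    have e : (schneiderCF p a - schneiderCF p b) * (1 + schneiderCF p fun k => a (k + 1))
        = -(schneiderCF p b
          * ((schneiderCF p fun k => a (k + 1)) - schneiderCF p fun k => b (k + 1))) := by
      linear_combination h1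
    have e' := congrArg norm e
    rw [norm_mul, n1, mul_one, norm_neg, norm_mul, n2, ih', ← pow_add] at e'
    rw [e', Finset.sum_range_succ']
    congr 1
    ring

end

/-! ### Quadratic approximations from periodic blocks -/

theorem sum_range_add_shift (a : ℕ → ℕ) (m n : ℕ) :
    ∑ k ∈ Finset.range (m + n), a k
      = ∑ k ∈ Finset.range m, a k + ∑ k ∈ Finset.range n, a (m + k) :=
  Finset.sum_range_add _ _ _

/-- The matrix of a period `(e, …, e, f)`. -/
theorem schneiderMatrix_period {p : ℕ} {a : ℕ → ℕ} {r s e f : ℕ} (hs : 0 < s)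
    (hw : ∀ k, k + 1 < s → a (r + k) = e)
    (hf : a (r + (s - 1)) = f) :
    schneiderMatrix p (fun k => a (r + k)) s
      = schneiderMatrix p (fun _ => e) (s - 1) * !![0, (p : ℤ) ^ f; 1, 1] := by
  obtain ⟨s, rfl⟩ : ∃ m, s = m + 1 := ⟨s - 1, by omega⟩
  rw [schneiderMatrix, schneiderMatrix_congr p (b := fun _ => e) fun k hk => hw k (by omega)]
  simp only [Nat.add_sub_cancel] at hf ⊢
  rw [hf]

/-- Away from p, g divides N₁₀ and N₁₁ - N₀₀. With M the matrix of the constant part of the period,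
this reads g ∣ M₁₁ and g ∣ M₁₀(p^f - p^e); and M₁₀ is prime to g because det M is ± a power of p. -/
theorem dvd_pow_sub_pow_of_coprime {p : ℕ} {a : ℕ → ℕ} {r s e f : ℕ} {g : ℤ}
    (hg : IsCoprime g (p : ℤ)) (hs : 0 < s)
    (hw : ∀ k, k + 1 < s → a (r + k) = e) (hf : a (r + (s - 1)) = f)
    (h : ∀ i, g ∣ (fixedPointPoly (schneiderMatrix p a r * schneiderMatrix p (fun k => a (r + k)) s
      * (schneiderMatrix p a r).adjugate)).coeff i) :
    g ∣ (p : ℤ) ^ f - (p : ℤ) ^ e := by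
  obtain ⟨h1, h2⟩ := dvd_of_dvd_fixedPointPoly_conj _ _ h
  rw [det_schneiderMatrix_sq] at h1 h2
  replace h1 := hg.pow_right.dvd_of_dvd_mul_left h1
  replace h2 := hg.pow_right.dvd_of_dvd_mul_left h2
  rw [schneiderMatrix_period hs hw hf] at h1 h2
  obtain ⟨c1, c2⟩ := schneiderMatrix_const p e (s - 1)
  have hdet := det_schneiderMatrix p (fun _ => e) (s - 1)
  rw [Matrix.det_fin_two] at hdet
  set M := schneiderMatrix p (fun _ => e) (s - 1)
  simp [Matrix.mul_apply, Fin.sum_univ_two] at h1 h2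
  have hdc : IsCoprime g (M 0 0 * M 1 1 - M 0 1 * M 1 0) := by
    rw [hdet]
    exact IsCoprime.mul_right isCoprime_one_right.neg_right.pow_right hg.pow_right
  obtain ⟨z, hz⟩ := h1
  have hc10 : IsCoprime g (M 1 0) := by
    have e1 : M 0 0 * M 1 1 - M 0 1 * M 1 0 = (-M 0 1) * M 1 0 + g * (M 0 0 * z) := by
      rw [hz]
      ring
    rw [e1, IsCoprime.add_mul_left_right_iff] at hdc
    exact hdc.of_mul_right_right
  refine hc10.dvd_of_dvd_mul_left ?_
  have e2 : M 1 0 * ((p : ℤ) ^ f - (p : ℤ) ^ e)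
      = M 1 0 * (p : ℤ) ^ f + M 1 1 - M 0 1 - M 1 1 := by
    rw [c1]
    ring
  rw [e2]
  exact dvd_sub h2 ⟨z, hz⟩

/-! ### Content, discriminant and height of the polynomial of a block -/

section
variable {p : ℕ} [hp : Fact p.Prime] {a : ℕ → ℕ} {r s e f : ℕ}

/-- Expanding q_(r+s-1) q_r - q_(r+s) q_(r-1) by the recurrence leaves a multiple of p^(a (r-1))
minus p^f times a product of two denominators, which are units at p. Since f < a (r-1), the p-adic
valuation is f; this is why a block opens with an exponent larger than f. -/
theorem not_pow_dvd_conj_one_zero (ha : ∀ k, 0 < a k) (hr : 0 < r) (hs : 2 ≤ s)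
    (hfr : f < a (r - 1)) (hf : a (r + (s - 1)) = f) :
    ¬ (p : ℤ) ^ (f + 1) ∣ (schneiderMatrix p a r * schneiderMatrix p (fun k => a (r + k)) s
      * (schneiderMatrix p a r).adjugate) 1 0 := by
  have hpz : Prime (p : ℤ) := Nat.prime_iff_prime_int.1 hp.out
  obtain ⟨r, rfl⟩ : ∃ m, r = m + 1 := ⟨r - 1, by omega⟩
  obtain ⟨s, rfl⟩ : ∃ m, s = m + 2 := ⟨s - 2, by omega⟩
  rw [← schneiderMatrix_add]
  have hu1 := dvd_schneiderMatrix_sub_one p ha r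
  have hu2 := dvd_schneiderMatrix_sub_one p ha (r + 1 + s)
  have e1 : (schneiderMatrix p a (r + 1 + (s + 2)) * (schneiderMatrix p a (r + 1)).adjugate) 1 0
      = (p : ℤ) ^ f * ((p : ℤ) ^ (a r - f) * (schneiderMatrix p a (r + 1 + s + 1) 1 1
        * schneiderMatrix p a r 1 0)
        - schneiderMatrix p a (r + 1 + s) 1 1 * schneiderMatrix p a r 1 1) := by
    have hpow : (p : ℤ) ^ a r = (p : ℤ) ^ f * (p : ℤ) ^ (a r - f) := by
      rw [← pow_add]
      congr 1
      simp at hfr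
      omega
    rw [show r + 1 + (s + 2) = r + 1 + s + 1 + 1 by ring, Matrix.adjugate_fin_two]
    simp only [Matrix.mul_apply, Fin.sum_univ_two, Matrix.of_apply, Matrix.cons_val',
      Matrix.cons_val_zero, Matrix.cons_val_one, Matrix.cons_val_fin_one]
    rw [schneiderMatrix_succ_zero p a (r + 1 + s + 1), schneiderMatrix_succ_one p a (r + 1 + s + 1),
      schneiderMatrix_succ_zero p a r, schneiderMatrix_succ_one p a r,
      schneiderMatrix_succ_zero p a (r + 1 + s), hpow]
    have : a (r + 1 + s + 1) = f := by
      rw [← hf]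
      congr 1
    rw [this]
    ring
  rw [e1, pow_succ]
  intro h
  have hp0 : (p : ℤ) ^ f ≠ 0 := pow_ne_zero _ hpz.ne_zero
  have h1 := (mul_dvd_mul_iff_left hp0).1 h
  have h2 : (p : ℤ) ∣ schneiderMatrix p a (r + 1 + s) 1 1 * schneiderMatrix p a r 1 1 :=
    (dvd_sub_right (dvd_mul_of_dvd_left (dvd_pow_self _ (by simp at hfr; omega)) _)).1 h1
  have hno : ∀ z : ℤ, (p : ℤ) ∣ z - 1 → ¬ (p : ℤ) ∣ z := fun z hz h' =>
    hpz.not_dvd_one (by simpa using dvd_sub h' hz)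
  rcases hpz.dvd_or_dvd h2 with h3 | h3
  · exact hno _ hu2 h3
  · exact hno _ hu1 h3

/-- The p-part of the content is at most p^f by the leading coefficient, and the part prime to p
divides p^f - p^e, nonzero because e < f. -/
theorem content_fixedPointPoly_le (ha : ∀ k, 0 < a k) (hr : 0 < r) (hs : 2 ≤ s) (hef : e < f)
    (hfr : f < a (r - 1)) (hw : ∀ k, k + 1 < s → a (r + k) = e) (hf : a (r + (s - 1)) = f) :
    |(fixedPointPoly (schneiderMatrix p a r * schneiderMatrix p (fun k => a (r + k)) s
      * (schneiderMatrix p a r).adjugate)).content| ≤ (p : ℤ) ^ (2 * f) := by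
  have hnd := not_pow_dvd_conj_one_zero (p := p) ha hr hs hfr hf
  have hdvd := fun g (hg : IsCoprime g (p : ℤ)) =>
    dvd_pow_sub_pow_of_coprime (a := a) (r := r) hg (by omega) hw hf
  have hc2 := (coeff_fixedPointPoly (schneiderMatrix p a r
    * schneiderMatrix p (fun k => a (r + k)) s * (schneiderMatrix p a r).adjugate)).1
  rw [← hc2] at hnd
  set F := fixedPointPoly (schneiderMatrix p a r * schneiderMatrix p (fun k => a (r + k)) s
    * (schneiderMatrix p a r).adjugate)
  have hg0 : F.content.natAbs ≠ 0 := by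
    rw [Int.natAbs_ne_zero, Ne, content_eq_zero_iff]
    intro h0
    rw [h0] at hnd
    simp at hnd
  obtain ⟨k, g, hg, hk⟩ := Nat.exists_eq_pow_mul_and_not_dvd hg0 p hp.out.ne_one
  have hgF : ∀ i, (g : ℤ) ∣ F.coeff i := fun i =>
    (Int.natCast_dvd.2 ⟨p ^ k, by rw [hk]; ring⟩ : (g : ℤ) ∣ F.content).trans (content_dvd_coeff i)
  have hcop : IsCoprime (g : ℤ) (p : ℤ) :=
    Nat.isCoprime_iff_coprime.2 ((Nat.Prime.coprime_iff_not_dvd hp.out).2 hg).symm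
  have hlt : (p : ℤ) ^ e < (p : ℤ) ^ f := pow_lt_pow_right₀ (by exact_mod_cast hp.out.one_lt) hef
  have hgle : (g : ℤ) ≤ (p : ℤ) ^ f := by
    have h1 := Int.le_of_dvd (by linarith) (hdvd g hcop hgF)
    have : 0 ≤ (p : ℤ) ^ e := by positivity
    linarith
  have hkf : k ≤ f := by
    by_contra hlt
    refine hnd (((pow_dvd_pow _ (by omega : f + 1 ≤ k)).trans ?_).trans (content_dvd_coeff 2))
    have : ((p ^ k : ℕ) : ℤ) ∣ F.content := Int.natCast_dvd.2 ⟨g, hk⟩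
    exact_mod_cast this
  rw [Int.abs_eq_natAbs, hk]
  push_cast
  calc (p : ℤ) ^ k * g ≤ (p : ℤ) ^ f * (p : ℤ) ^ f := by
        have : (1 : ℤ) ≤ p := by exact_mod_cast hp.out.one_lt.le
        gcongr
    _ = _ := by ring

/-- The discriminant of the matrix of a period of large exponents is not a square. -/
theorem not_isSquare_discrim_schneiderMatrix (ha : ∀ k, 0 < a k) (hup : ∀ k, a (k + 1) ≤ a k + 7)
    (hs : 2 ≤ s) (he : ∀ k, a 0 ≤ a k ∨ s ≤ k) (h0 : 22 ≤ a 0) :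
    ¬ IsSquare ((schneiderMatrix p a s).trace ^ 2 - 4 * (schneiderMatrix p a s).det) := by
  have hp2 : (2 : ℤ) ≤ p := by exact_mod_cast hp.out.two_le
  have hpz : Prime (p : ℤ) := Nat.prime_iff_prime_int.1 hp.out
  set S := ∑ k ∈ Finset.range s, a k with hS
  have hSge : s * a 0 ≤ S := by
    have := Finset.card_nsmul_le_sum (Finset.range s) a (a 0) fun k hk =>
      (he k).resolve_right (by simpa using hk)
    simpa using this
  -- As S ≥ s·a_0 with s ≥ 2, what is needed is S ≥ 9s + a_0 + 4; at s = 2 this is a_0 ≥ 22. It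
  -- makes each matrix entry at most p^(S-2), so the trace is below p^S - 1.
  have hS2 : S + 9 * s + a 0 ≤ 2 * (S - 2) := by
    obtain ⟨s, rfl⟩ : ∃ m, s = m + 2 := ⟨s - 2, by omega⟩
    have h22 : s * 22 ≤ s * a 0 := Nat.mul_le_mul_left _ h0
    have : (s + 2) * a 0 = s * a 0 + 2 * a 0 := by ring
    omega
  refine not_isSquare_sq_sub (S := S) hp.out ?_ ?_ ?_
  · rw [det_schneiderMatrix, Int.natAbs_mul, Int.natAbs_pow, Int.natAbs_pow]
    simp [hS]
  · rw [Matrix.trace_fin_two]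
    obtain ⟨n, rfl⟩ : ∃ m, s = m + 1 := ⟨s - 1, by omega⟩
    intro h
    have h1 := (dvd_schneiderMatrix p ha n).2
    have h2 := (dvd_add_right h1).1 h
    exact hpz.not_dvd_one (by simpa using dvd_sub h2 (dvd_schneiderMatrix_sub_one p ha (n + 1)))
  · have hent : ∀ i j, schneiderMatrix p a s i j ≤ (p : ℤ) ^ (S - 2) := fun i j => by
      have h1 := schneiderMatrix_sq_le hp.out.two_le hup (by omega : 0 < s) i j
      refine le_of_sq_le_sq (h1.trans ?_) (by positivity)
      rw [← pow_mul, mul_comm _ 2]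
      exact pow_le_pow_right₀ (by linarith) hS2
    rw [Matrix.trace_fin_two, abs_of_nonneg (add_nonneg (schneiderMatrix_nonneg p a s 0 0)
      (schneiderMatrix_nonneg p a s 1 1))]
    have hpow : (p : ℤ) ^ S = (p : ℤ) ^ (S - 2) * (p : ℤ) ^ 2 := by
      rw [← pow_add]
      congr 1
      omega
    have h3 : (1 : ℤ) ≤ (p : ℤ) ^ (S - 2) := one_le_pow₀ (by linarith)
    have h4 : 4 ≤ (p : ℤ) ^ 2 := by nlinarith
    have := hent 0 0
    have := hent 1 1
    rw [hpow]
    nlinarith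

/-- Each coefficient is a difference of two nonnegative quantities, each a sum of at most two
products of entries. It is therefore bounded by the larger of them, whence 4 rather than 16. -/
theorem supNorm_fixedPointPoly_sq_le {M R : Matrix (Fin 2) (Fin 2) ℤ} {B : ℤ}
    (hM : ∀ i j, 0 ≤ M i j) (hR : ∀ i j, 0 ≤ R i j)
    (hB : ∀ i j k l, M i j ^ 2 * R k l ^ 2 ≤ B) :
    (fixedPointPoly (M * R.adjugate)).supNorm ^ 2 ≤ 4 * (B : ℝ) := by
  have key : ∀ x y z v : ℤ, 0 ≤ x → 0 ≤ y → 0 ≤ z → 0 ≤ v → x ^ 2 ≤ B → y ^ 2 ≤ B → z ^ 2 ≤ B →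
      v ^ 2 ≤ B → (x + y - (z + v)) ^ 2 ≤ 4 * B := by
    intro x y z v hx hy hz hv hx' hy' hz' hv'
    rcases le_total (x + y) (z + v) with h | h
    · have : (x + y - (z + v)) ^ 2 ≤ (z + v) ^ 2 := by
        rw [sq_le_sq, abs_of_nonneg (add_nonneg hz hv), abs_le]
        constructor <;> linarith
      nlinarith [sq_nonneg (z - v)]
    · have : (x + y - (z + v)) ^ 2 ≤ (x + y) ^ 2 := by
        rw [sq_le_sq, abs_of_nonneg (add_nonneg hx hy), abs_le]
        constructor <;> linarith
      nlinarith [sq_nonneg (x - y)]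
  have hpos : ∀ i j k l, 0 ≤ M i j * R k l := fun i j k l => mul_nonneg (hM i j) (hR k l)
  have hB' : ∀ i j k l, (M i j * R k l) ^ 2 ≤ B := fun i j k l => by
    rw [mul_pow]
    exact hB i j k l
  have hB0 : 0 ≤ B := (sq_nonneg _).trans (hB' 0 0 0 0)
  have hcoeff : ∀ i, (fixedPointPoly (M * R.adjugate)).coeff i ^ 2 ≤ 4 * B := by
    have hG : M * R.adjugate = !![M 0 0 * R 1 1 - M 0 1 * R 1 0, M 0 1 * R 0 0 - M 0 0 * R 0 1;
        M 1 0 * R 1 1 - M 1 1 * R 1 0, M 1 1 * R 0 0 - M 1 0 * R 0 1] := by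
      ext i j
      fin_cases i <;> fin_cases j <;>
        simp [Matrix.mul_apply, Fin.sum_univ_two, Matrix.adjugate_fin_two] <;> ring
    obtain ⟨h2, h1, h0⟩ := coeff_fixedPointPoly (M * R.adjugate)
    rw [hG] at h2 h1 h0
    rw [hG]
    intro i
    match i with
    | 0 =>
      rw [h0]
      have := key _ 0 _ 0 (hpos 0 0 0 1) le_rfl (hpos 0 1 0 0) le_rfl (hB' 0 0 0 1) (by simpa)
        (hB' 0 1 0 0) (by simpa)
      simpa using this
    | 1 =>
      rw [h1]
      have := key _ _ _ _ (hpos 1 1 0 0) (hpos 0 1 1 0) (hpos 1 0 0 1) (hpos 0 0 1 1)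
        (hB' 1 1 0 0) (hB' 0 1 1 0) (hB' 1 0 0 1) (hB' 0 0 1 1)
      refine le_of_eq_of_le ?_ this
      simp
      ring
    | 2 =>
      rw [h2]
      have := key _ 0 _ 0 (hpos 1 0 1 1) le_rfl (hpos 1 1 1 0) le_rfl (hB' 1 0 1 1) (by simpa)
        (hB' 1 1 1 0) (by simpa)
      simpa using this
    | n + 3 =>
      rw [coeff_eq_zero_of_natDegree_lt ((natDegree_fixedPointPoly_le _).trans_lt (by omega))]
      simpa using hB0
  obtain ⟨i, hi⟩ := (fixedPointPoly (M * R.adjugate)).exists_eq_supNorm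
  rw [hi, Int.norm_eq_abs, sq_abs]
  exact_mod_cast hcoeff i

theorem abs_discrim_le (P : ℤ[X]) :
    (P.coeff 1 : ℝ) ^ 2 - 4 * P.coeff 2 * P.coeff 0 ≤ 5 * P.supNorm ^ 2 := by
  have h0 := abs_le.1 (abs_coeff_le_supNorm P 0)
  have h1 := abs_le.1 (abs_coeff_le_supNorm P 1)
  have h2 := abs_le.1 (abs_coeff_le_supNorm P 2)
  nlinarith [sq_nonneg ((P.coeff 2 : ℝ) + P.coeff 0)]

/-- The discriminant is (N₁₁-N₀₀)² + 4N₀₁N₁₀, hence at least 4N₀₁N₁₀. The entry N₁₀ is a denominator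
one index earlier, which costs the last exponent `a (s - 1)`. -/
theorem pow_le_discrim_schneiderMatrix_sq (hup : ∀ k, a (k + 1) ≤ a k + 7)
    (hdn : ∀ k, a k ≤ a (k + 1) + 7) (hs : 2 ≤ s) :
    16 * (p : ℤ) ^ (2 * ∑ k ∈ Finset.range s, a k)
      ≤ ((schneiderMatrix p a s).trace ^ 2 - 4 * (schneiderMatrix p a s).det) ^ 2
        * (p : ℤ) ^ (14 * s + 4 * a 0 + a (s - 1)) := by
  have hp1 : (1 : ℤ) ≤ p := by exact_mod_cast hp.out.one_lt.le
  obtain ⟨n, rfl⟩ : ∃ m, s = m + 1 := ⟨s - 1, by omega⟩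
  have h1 := pow_le_schneiderMatrix_sq (p := p) hp.out.two_le hup hdn (by omega : 0 < n + 1) 0
  have h2 := pow_le_schneiderMatrix_sq (p := p) hp.out.two_le hup hdn (by omega : 0 < n) 1
  rw [← schneiderMatrix_succ_zero] at h2
  have hsum := Finset.sum_range_succ a n
  set S := ∑ k ∈ Finset.range (n + 1), a k
  set S' := ∑ k ∈ Finset.range n, a k
  set N := schneiderMatrix p a (n + 1)
  have hd : N.trace ^ 2 - 4 * N.det = (N 1 1 - N 0 0) ^ 2 + 4 * (N 0 1 * N 1 0) := by
    rw [Matrix.trace_fin_two, Matrix.det_fin_two]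
    ring
  have hnn : 0 ≤ N 0 1 * N 1 0 :=
    mul_nonneg (schneiderMatrix_nonneg p a _ 0 1) (schneiderMatrix_nonneg p a _ 1 0)
  have h3 : 16 * (N 0 1 * N 1 0) ^ 2 ≤ (N.trace ^ 2 - 4 * N.det) ^ 2 := by
    rw [hd]
    nlinarith [sq_nonneg (N 1 1 - N 0 0), mul_nonneg (sq_nonneg (N 1 1 - N 0 0)) hnn]
  have e1 : 2 * S = S + S' + a n := by rw [hsum]; ring
  rw [e1, pow_add, pow_add]
  calc 16 * ((p : ℤ) ^ S * (p : ℤ) ^ S' * (p : ℤ) ^ a n)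
      ≤ 16 * ((N 0 1 ^ 2 * (p : ℤ) ^ (7 * (n + 1) + 2 * a 0))
          * (N 1 0 ^ 2 * (p : ℤ) ^ (7 * n + 2 * a 0)) * (p : ℤ) ^ a n) := by gcongr
    _ = 16 * (N 0 1 * N 1 0) ^ 2 * (p : ℤ) ^ (14 * n + 7 + 4 * a 0 + a n) := by ring
    _ ≤ _ := by
      refine mul_le_mul h3 (pow_le_pow_right₀ hp1 ?_) (by positivity) (by positivity)
      simp only [Nat.add_sub_cancel]
      omega

end

/-- Lower bound for the height from the discriminant: `H'` is the height before and `H` after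
division by the content, `D` the discriminant of the period. The final +1 in the exponent absorbs
25/16 ≤ q. -/
theorem pow_le_pow_four_mul_pow {q D H H' : ℝ} {S₁ S₂ s e f : ℕ} (hq : 2 ≤ q) (hef : e ≤ f)
    (hD0 : 0 ≤ D) (hH' : 0 ≤ H') (h1 : q ^ (2 * S₁) * D ≤ 5 * H' ^ 2)
    (h2 : 16 * q ^ (2 * S₂) ≤ D ^ 2 * q ^ (14 * s + 4 * e + f)) (h3 : H' ≤ q ^ (2 * f) * H) :
    q ^ (2 * (S₁ + (S₁ + S₂))) ≤ H ^ 4 * q ^ (14 * s + 13 * f + 1) := by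
  have hq1 : 1 ≤ q := by linarith
  have h4 : H' ^ 4 ≤ q ^ (8 * f) * H ^ 4 := by
    refine (pow_le_pow_left₀ hH' h3 4).trans_eq ?_
    rw [mul_pow, ← pow_mul]
    congr 2
    ring
  have hsq : (q ^ (2 * S₁) * D) ^ 2 ≤ (5 * H' ^ 2) ^ 2 := pow_le_pow_left₀ (by positivity) h1 2
  have e1 : 16 * q ^ (2 * (S₁ + (S₁ + S₂))) ≤ 25 * (H ^ 4 * q ^ (14 * s + 13 * f)) := by
    calc 16 * q ^ (2 * (S₁ + (S₁ + S₂)))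
        = q ^ (4 * S₁) * (16 * q ^ (2 * S₂)) := by ring
      _ ≤ q ^ (4 * S₁) * (D ^ 2 * q ^ (14 * s + 4 * e + f)) :=
          mul_le_mul_of_nonneg_left h2 (by positivity)
      _ = (q ^ (2 * S₁) * D) ^ 2 * q ^ (14 * s + 4 * e + f) := by ring
      _ ≤ (5 * H' ^ 2) ^ 2 * q ^ (14 * s + 4 * e + f) :=
          mul_le_mul_of_nonneg_right hsq (by positivity)
      _ = 25 * H' ^ 4 * q ^ (14 * s + 4 * e + f) := by ring
      _ ≤ 25 * (q ^ (8 * f) * H ^ 4) * q ^ (14 * s + 4 * e + f) := by gcongr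
      _ = 25 * (H ^ 4 * q ^ (8 * f + (14 * s + 4 * e + f))) := by ring
      _ ≤ _ := by
        refine mul_le_mul_of_nonneg_left (mul_le_mul_of_nonneg_left
          (pow_le_pow_right₀ hq1 (by omega)) (by positivity)) (by norm_num)
  have hY : 0 ≤ H ^ 4 * q ^ (14 * s + 13 * f) := by positivity
  rw [pow_succ q (14 * s + 13 * f), ← mul_assoc]
  nlinarith

section
variable {p : ℕ} [hp : Fact p.Prime] {a : ℕ → ℕ} {r s : ℕ}

/-- The value at a continued fraction of the quadratic polynomial of a block of its partial
quotients. -/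
theorem norm_aeval_fixedPointPoly_schneiderCF (ha : ∀ k, 0 < a k) (r s : ℕ) :
    ‖aeval (schneiderCF p a) (fixedPointPoly (schneiderMatrix p a r
        * schneiderMatrix p (fun k => a (r + k)) s * (schneiderMatrix p a r).adjugate))‖
      = (p : ℝ)⁻¹ ^ (∑ k ∈ Finset.range r, a k + ∑ k ∈ Finset.range (r + s), a k)
        * ‖schneiderCF p (fun k => a (r + s + k)) - schneiderCF p fun k => a (r + k)‖ := by
  have h1 := congrArg norm (sq_mul_aeval_fixedPointPoly_conj _
    (schneiderMatrix p (fun k => a (r + k)) s) (schneiderCF_mul_eq (p := p) ha r))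
  have h2 := congrArg norm (mul_aeval_fixedPointPoly _
    (schneiderCF_mul_eq (p := p) (a := fun k => a (r + k)) (fun k => ha _) s))
  have hdet : ∀ (b : ℕ → ℕ) n, ‖((schneiderMatrix p b n).det : ℚ_[p])‖
      = (p : ℝ)⁻¹ ^ ∑ k ∈ Finset.range n, b k := fun b n => by
    rw [det_schneiderMatrix]
    push_cast
    rw [norm_mul, norm_pow, norm_pow, norm_neg, norm_one, one_pow, one_mul, Padic.norm_p]
  rw [norm_mul, norm_pow, norm_schneiderMatrix_mul_add ha r
    (norm_schneiderCF_lt_one fun k => ha _), one_pow, one_mul, norm_mul, norm_pow, hdet] at h1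
  rw [norm_mul, norm_schneiderMatrix_mul_add (fun k => ha _) s
    (norm_schneiderCF_lt_one fun k => ha _), one_mul, norm_mul, hdet] at h2
  rw [h1, h2, sum_range_add_shift]
  simp only [add_assoc]
  ring

set_option maxHeartbeats 800000 in
/-- A block of partial quotients followed by several repetitions of a period gives a quadratic
approximation. -/
theorem exists_quadratic_approximation (ha : ∀ k, 0 < a k) (hup : ∀ k, a (k + 1) ≤ a k + 7)
    (hdn : ∀ k, a k ≤ a (k + 1) + 7) {e f L : ℕ} (hr : 0 < r) (hs : 2 ≤ s) (he : 22 ≤ e)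
    (hef : e < f) (hfr : f < a (r - 1)) (hw : ∀ k, k + 1 < s → a (r + k) = e)
    (hf : a (r + (s - 1)) = f) (hL : r + s ≤ L)
    (hper : ∀ k, r + s + k < L → a (r + s + k) = a (r + k))
    (hlast : a (r + (L - (r + s))) < a L) :
    ∃ (P : ℤ[X]) (α : ℚ_[p]), Irreducible P ∧ P.natDegree = 2 ∧ aeval α P = 0 ∧
      ‖schneiderCF p a - α‖
        = (p : ℝ)⁻¹ ^ (∑ k ∈ Finset.range L, a k + a (r + (L - (r + s)))) ∧
      P.supNorm ^ 2 ≤ 4 * (p : ℝ) ^ (∑ k ∈ Finset.range r, a k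
        + ∑ k ∈ Finset.range (r + s), a k + 18 * (r + s) + 2 * a 0) ∧
      (p : ℝ) ^ (2 * (∑ k ∈ Finset.range r, a k + ∑ k ∈ Finset.range (r + s), a k))
        ≤ P.supNorm ^ 4 * (p : ℝ) ^ (14 * s + 13 * f + 1) ∧
      (p : ℝ)⁻¹ ^ (∑ k ∈ Finset.range r, a k + ∑ k ∈ Finset.range L, a k + a (r + (L - (r + s))))
        ≤ ‖aeval (schneiderCF p a) P‖ ∧
      ‖aeval (schneiderCF p a) P‖ ≤ (p : ℝ) ^ (2 * f) * (p : ℝ)⁻¹ ^ (∑ k ∈ Finset.range r, a k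
        + ∑ k ∈ Finset.range L, a k + a (r + (L - (r + s)))) := by
  have hp2 : (2 : ℝ) ≤ p := by exact_mod_cast hp.out.two_le
  have hp1 : (1 : ℝ) ≤ p := by linarith
  have hp0 : (0 : ℝ) < p := by linarith
  have har : a r = e := by simpa using hw 0 (by omega)
  have hcont := content_fixedPointPoly_le (p := p) ha hr hs hef hfr hw hf
  have hnd := not_pow_dvd_conj_one_zero (p := p) ha hr hs hfr hf
  have hG10 : (schneiderMatrix p a r * schneiderMatrix p (fun k => a (r + k)) s
      * (schneiderMatrix p a r).adjugate) 1 0 ≠ 0 := fun h0 => by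
    rw [h0] at hnd
    exact hnd (dvd_zero _)
  have hdeg := natDegree_fixedPointPoly hG10
  have hdisc := discrim_fixedPointPoly_conj (schneiderMatrix p a r)
    (schneiderMatrix p (fun k => a (r + k)) s)
  have hval := norm_aeval_fixedPointPoly_schneiderCF (p := p) ha r s
  have hsup := supNorm_fixedPointPoly_sq_le (M := schneiderMatrix p a (r + s))
    (R := schneiderMatrix p a r) (B := (p : ℤ) ^ (∑ k ∈ Finset.range r, a k
        + ∑ k ∈ Finset.range (r + s), a k + 18 * (r + s) + 2 * a 0))
    (schneiderMatrix_nonneg p a _) (schneiderMatrix_nonneg p a _) fun i j k l => by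
      have h1 := schneiderMatrix_sq_le hp.out.two_le hup (by omega : 0 < r + s) i j
      have h2 := schneiderMatrix_sq_le hp.out.two_le hup hr k l
      refine (mul_le_mul h1 h2 (sq_nonneg _) (by positivity)).trans ?_
      rw [← pow_add]
      exact pow_le_pow_right₀ (by exact_mod_cast hp.out.one_lt.le) (by omega)
  rw [schneiderMatrix_add] at hsup
  have hnsq : ¬ IsSquare ((schneiderMatrix p (fun k => a (r + k)) s).trace ^ 2
      - 4 * (schneiderMatrix p (fun k => a (r + k)) s).det) := by
    refine not_isSquare_discrim_schneiderMatrix (fun k => ha _) (fun k => hup _) hs (fun k => ?_)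
      (by simpa [har] using he)
    simp only [add_zero, har]
    rcases lt_trichotomy (k + 1) s with h | h | h
    · exact Or.inl (hw k h).ge
    · left
      obtain rfl : k = s - 1 := by omega
      rw [hf]
      exact hef.le
    · exact Or.inr (by omega)
  have hdl := pow_le_discrim_schneiderMatrix_sq (p := p) (a := fun k => a (r + k)) (s := s)
    (fun k => hup _) (fun k => hdn _) hs
  simp only [add_zero, har, hf] at hdl
  have hdetR := det_schneiderMatrix_sq p a r
  set N := schneiderMatrix p (fun k => a (r + k)) s with hN
  set R := schneiderMatrix p a r with hR
  set F := fixedPointPoly (R * N * R.adjugate) with hF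
  have hF0 : F ≠ 0 := fun h0 => by
    rw [h0, natDegree_zero] at hdeg
    omega
  have hg0 : F.content ≠ 0 := by rwa [Ne, content_eq_zero_iff]
  have hFP : F = C F.content * F.primPart := F.eq_C_content_mul_primPart
  have hPdeg : F.primPart.natDegree = 2 := by rw [natDegree_primPart, hdeg]
  have hirr : Irreducible F.primPart := by
    refine irreducible_of_not_isSquare_discrim F.isPrimitive_primPart hPdeg ?_
    rintro ⟨y, hy⟩
    -- A square discriminant for the primitive part would make det(R)² times the discriminant of N a
    -- square, hence also the latter.
    have e1 : F.coeff 1 ^ 2 - 4 * F.coeff 2 * F.coeff 0 = (F.content * y) ^ 2 := by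
      have hc : ∀ i, F.coeff i = F.content * F.primPart.coeff i := fun i => by
        conv_lhs => rw [hFP]
        exact coeff_C_mul _
      rw [hc, hc, hc]
      linear_combination F.content ^ 2 * hy
    rw [hdisc] at e1
    have hRdet : R.det ≠ 0 := fun h0 => by
      rw [h0] at hdetR
      have : (p : ℤ) ^ (2 * ∑ k ∈ Finset.range r, a k) ≠ 0 :=
        pow_ne_zero _ (by exact_mod_cast hp.out.ne_zero)
      exact this (by rw [← hdetR]; ring)
    obtain ⟨z, hz⟩ := (Int.pow_dvd_pow_iff two_ne_zero).1 (Dvd.intro _ e1)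
    refine hnsq ⟨z, mul_left_cancel₀ (pow_ne_zero 2 hRdet) ?_⟩
    rw [e1, hz]
    ring
  have hsupF : F.supNorm = |(F.content : ℝ)| * F.primPart.supNorm := by
    conv_lhs => rw [hFP]
    exact supNorm_C_mul_int _ _
  have hgle : |(F.content : ℝ)| ≤ (p : ℝ) ^ (2 * f) := by exact_mod_cast hcont
  have hg1 : 1 ≤ |(F.content : ℝ)| := by exact_mod_cast Int.one_le_abs hg0
  have hP1 := one_le_supNorm hirr.ne_zero
  have hevF : ∀ x : ℚ_[p], aeval x F = F.content * aeval x F.primPart := fun x => by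
    conv_lhs => rw [hFP]
    simp
  have hgn1 : ‖(F.content : ℚ_[p])‖ ≤ 1 := Padic.norm_int_le_one _
  have hgn2 : 1 ≤ (p : ℝ) ^ (2 * f) * ‖(F.content : ℚ_[p])‖ :=
    (one_le_abs_mul_norm_int hg0).trans (mul_le_mul_of_nonneg_right hgle (norm_nonneg _))
  have hdiff : ‖schneiderCF p (fun k => a (r + s + k)) - schneiderCF p fun k => a (r + k)‖
      = (p : ℝ)⁻¹ ^ (∑ k ∈ Finset.range (L - (r + s)), a (r + s + k)
        + a (r + (L - (r + s)))) := by
    rw [norm_schneiderCF_sub (fun k => ha _) (fun k => ha _) (n := L - (r + s))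
      (fun k hk => hper k (by omega)) (by rwa [show r + s + (L - (r + s)) = L by omega])]
    congr 2
    exact Finset.sum_congr rfl fun k hk =>
      (hper k (by have := Finset.mem_range.1 hk; omega)).symm
  have hSL : ∑ k ∈ Finset.range L, a k = ∑ k ∈ Finset.range (r + s), a k
      + ∑ k ∈ Finset.range (L - (r + s)), a (r + s + k) := by
    rw [← sum_range_add_shift, show r + s + (L - (r + s)) = L by omega]
  rw [hdiff, ← pow_add, hevF, norm_mul] at hval
  have hexp : ∑ k ∈ Finset.range r, a k + ∑ k ∈ Finset.range (r + s), a k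
      + (∑ k ∈ Finset.range (L - (r + s)), a (r + s + k) + a (r + (L - (r + s))))
      = ∑ k ∈ Finset.range r, a k + ∑ k ∈ Finset.range L, a k + a (r + (L - (r + s))) := by
    rw [hSL]
    ring
  rw [hexp] at hval
  -- The ultimately periodic sequence of α: the preperiod of length r, then the word (e, …, e, f)
  -- for ever. It agrees with `a` before `L` and is smaller at `L`.
  set b : ℕ → ℕ := fun k => if k < r then a k else if (k - r) % s = s - 1 then f else e with hb
  have hbpos : ∀ k, 0 < b k := fun k => by
    simp only [hb]
    split_ifs
    · exact ha k
    · omega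
    · omega
  have hbr : ∀ k < r, b k = a k := fun k hk => if_pos hk
  have hbs : ∀ k < s, b (r + k) = a (r + k) := fun k hk => by
    simp only [hb, Nat.add_sub_cancel_left, Nat.mod_eq_of_lt hk, if_neg (by omega : ¬ r + k < r)]
    split_ifs with h
    · rw [h, hf]
    · rw [hw k (by omega)]
  have hbper : ∀ k, b (r + s + k) = b (r + k) := fun k => by
    have e1 : r + s + k - r = s + k := by omega
    simp only [hb, if_neg (by omega : ¬ r + k < r), if_neg (by omega : ¬ r + s + k < r), e1,
      Nat.add_sub_cancel_left, Nat.add_mod_left]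
  have hbL : ∀ k < L, a k = b k := fun k => by
    induction k using Nat.strong_induction_on with
    | _ k ih =>
      intro hk
      by_cases h1 : k < r
      · exact (hbr k h1).symm
      by_cases h2 : k < r + s
      · obtain ⟨j, rfl⟩ := Nat.exists_eq_add_of_le (not_lt.1 h1)
        exact (hbs j (by omega)).symm
      · obtain ⟨j, rfl⟩ := Nat.exists_eq_add_of_le (not_lt.1 h2)
        rw [hper j hk, hbper]
        exact ih _ (by omega) (by omega)
  have hbLL : b L = a (r + (L - (r + s))) := by
    rw [hbL _ (by omega), ← hbper]
    congr 1
    omega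
  -- For `b` the complete quotients at r and r + s coincide, so the value formula gives 0.
  have hroot : aeval (schneiderCF p b) F = 0 := by
    have h1 := norm_aeval_fixedPointPoly_schneiderCF (p := p) hbpos r s
    have e1 : schneiderMatrix p b r = R := schneiderMatrix_congr p hbr
    have e2 : schneiderMatrix p (fun k => b (r + k)) s = N := schneiderMatrix_congr p hbs
    have e3 : (fun k => b (r + s + k)) = fun k => b (r + k) := funext hbper
    rw [e1, e2, e3, sub_self, norm_zero, mul_zero] at h1
    exact norm_eq_zero.1 h1
  refine ⟨F.primPart, schneiderCF p b, hirr, hPdeg, ?_, ?_, ?_, ?_, ?_, ?_⟩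
  · rw [hevF] at hroot
    exact (mul_eq_zero.1 hroot).resolve_left (by exact_mod_cast hg0)
  · rw [norm_schneiderCF_sub ha hbpos hbL (by rwa [hbLL]), hbLL]
    congr 2
    exact Finset.sum_congr rfl fun k hk => (hbL k (Finset.mem_range.1 hk)).symm
  · push_cast at hsup
    refine le_trans (pow_le_pow_left₀ F.primPart.supNorm_nonneg ?_ 2) hsup
    rw [hsupF]
    exact le_mul_of_one_le_left F.primPart.supNorm_nonneg hg1
  · have hd5 := abs_discrim_le F
    have hdisc' : (F.coeff 1 : ℝ) ^ 2 - 4 * F.coeff 2 * F.coeff 0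
        = (p : ℝ) ^ (2 * ∑ k ∈ Finset.range r, a k) * ((N.trace ^ 2 - 4 * N.det : ℤ) : ℝ) := by
      rw [hdetR] at hdisc
      exact_mod_cast hdisc
    have hdl' : 16 * (p : ℝ) ^ (2 * ∑ k ∈ Finset.range s, a (r + k))
        ≤ ((N.trace ^ 2 - 4 * N.det : ℤ) : ℝ) ^ 2 * (p : ℝ) ^ (14 * s + 4 * e + f) := by
      exact_mod_cast hdl
    have hD0 : 0 ≤ ((N.trace ^ 2 - 4 * N.det : ℤ) : ℝ) := by
      have e : N.trace ^ 2 - 4 * N.det = (N 1 1 - N 0 0) ^ 2 + 4 * (N 0 1 * N 1 0) := by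
        rw [Matrix.trace_fin_two, Matrix.det_fin_two]
        ring
      have hnn : 0 ≤ N 0 1 * N 1 0 :=
        mul_nonneg (schneiderMatrix_nonneg p _ _ 0 1) (schneiderMatrix_nonneg p _ _ 1 0)
      rw [e]
      exact_mod_cast add_nonneg (sq_nonneg _) (mul_nonneg (by norm_num) hnn)
    rw [hdisc'] at hd5
    rw [sum_range_add_shift a r s]
    refine pow_le_pow_four_mul_pow hp2 hef.le hD0 F.supNorm_nonneg hd5
      hdl' ?_
    rw [hsupF]
    exact mul_le_mul_of_nonneg_right hgle F.primPart.supNorm_nonneg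
  · rw [← hval]
    exact mul_le_of_le_one_left (norm_nonneg _) hgn1
  · rw [← hval, ← mul_assoc]
    exact le_mul_of_one_le_left (norm_nonneg _) hgn2

end

/-! ### The sequence of exponents: blocks and partial sums -/

section
variable {w η : ℝ} {b : ℕ} {ε : ℕ → ℕ}

theorem schneiderExponents_mem_block (hw : 2 ≤ w) (hε : ∀ j, ε j = 0 ∨ ε j = 1) {i n : ℕ}
    (h1 : ⌊w ^ i⌋₊ ≤ n) (h2 : n < ⌊w ^ (i + 1)⌋₊) :
    b + 4 * i ≤ schneiderExponents w η b ε n ∧ schneiderExponents w η b ε n ≤ b + 4 * i + 3 := by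
  simp only [schneiderExponents, blockIndex_eq hw h1 h2]
  have := hε i
  split_ifs <;> omega

theorem floor_pow_lt_succ (hw : 2 ≤ w) (i : ℕ) : ⌊w ^ i⌋₊ < ⌊w ^ (i + 1)⌋₊ := by
  have h1 : 1 ≤ w ^ i := one_le_pow₀ (by linarith)
  refine Nat.lt_of_succ_le (Nat.le_floor ?_)
  have := Nat.floor_le (zero_le_one.trans h1)
  push_cast
  rw [pow_succ]
  nlinarith

theorem exists_block (hw : 2 ≤ w) {n : ℕ} (hn : 1 ≤ n) :
    ∃ i, ⌊w ^ i⌋₊ ≤ n ∧ n < ⌊w ^ (i + 1)⌋₊ := by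
  induction n, hn using Nat.le_induction with
  | base => exact ⟨0, by simp, by simpa using floor_pow_lt_succ hw 0⟩
  | succ n _ ih =>
    obtain ⟨i, h1, h2⟩ := ih
    rcases (Nat.succ_le_of_lt h2).lt_or_eq with h | h
    · exact ⟨i, by omega, h⟩
    · exact ⟨i + 1, h.ge, h.trans_lt (floor_pow_lt_succ hw _)⟩

/-- The extreme jump is at a change of block, from at least b+4i to b+4(i+1)+3; this is the 7 of the
growth estimates. -/
theorem schneiderExponents_succ_le (hw : 2 ≤ w) (hε : ∀ j, ε j = 0 ∨ ε j = 1) {n : ℕ}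
    (hn : 1 ≤ n) :
    schneiderExponents w η b ε (n + 1) ≤ schneiderExponents w η b ε n + 7 ∧
    schneiderExponents w η b ε n ≤ schneiderExponents w η b ε (n + 1) + 7 := by
  obtain ⟨i, h1, h2⟩ := exists_block hw hn
  have h3 := schneiderExponents_mem_block (η := η) (b := b) hw hε h1 h2
  rcases (show n + 1 ≤ _ from h2).lt_or_eq with h | h
  · have h4 := schneiderExponents_mem_block (η := η) (b := b) hw hε (by omega) h
    omega
  · have h4 := schneiderExponents_floor hw η b ε (i + 1)
    rw [← h] at h4
    omega

theorem schneiderExponents_add_period (hw : 2 ≤ w) {i j : ℕ} (hj : 0 < j)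
    (h : ⌊w ^ i⌋₊ + ⌊η * w ^ i⌋₊ + j < ⌊w ^ (i + 1)⌋₊) :
    schneiderExponents w η b ε (⌊w ^ i⌋₊ + ⌊η * w ^ i⌋₊ + j)
      = schneiderExponents w η b ε (⌊w ^ i⌋₊ + j) := by
  have e1 : ⌊w ^ i⌋₊ + ⌊η * w ^ i⌋₊ + j - ⌊w ^ i⌋₊ = ⌊η * w ^ i⌋₊ + j := by omega
  have e2 : ⌊w ^ i⌋₊ + j - ⌊w ^ i⌋₊ = j := by omega
  by_cases hd : ⌊η * w ^ i⌋₊ ∣ j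
  · rw [schneiderExponents_of_dvd hw η b ε (i := i) (by omega) h
        (by rw [e1]; exact dvd_add dvd_rfl hd),
      schneiderExponents_of_dvd hw η b ε (i := i) (by omega) (by omega) (by rwa [e2])]
  · rw [schneiderExponents_of_not_dvd hw η b ε (i := i) (by omega) h
        (by rwa [e1, Nat.dvd_add_right dvd_rfl]),
      schneiderExponents_of_not_dvd hw η b ε (i := i) (by omega) (by omega) (by rwa [e2])]

theorem sum_schneiderExponents_step (hw : 2 ≤ w) (hε : ∀ j, ε j = 0 ∨ ε j = 1) {i j N : ℕ}
    (hN : N + 1 = ⌊w ^ i⌋₊) (hj : N + j + 1 ≤ ⌊w ^ (i + 1)⌋₊) :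
    ∑ k ∈ Finset.range N, schneiderExponents w η b ε (k + 1) + 4 * i * j
      ≤ ∑ k ∈ Finset.range (N + j), schneiderExponents w η b ε (k + 1) ∧
    ∑ k ∈ Finset.range (N + j), schneiderExponents w η b ε (k + 1)
      ≤ ∑ k ∈ Finset.range N, schneiderExponents w η b ε (k + 1) + (4 * i + b + 3) * j := by
  induction j with
  | zero => simp
  | succ j ih =>
    obtain ⟨h1, h2⟩ := ih (by omega)
    have h3 := schneiderExponents_mem_block (η := η) (b := b) (n := N + j + 1) hw hε
      (i := i) (by omega) (by omega)
    rw [← add_assoc N j 1, Finset.sum_range_succ, mul_add, mul_add]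
    omega

/-- Counting all earlier exponents as about 4i overestimates them by a geometrically weighted
amount. The constant 8 closes the induction because 8w^(i+1) - 8w^i ≥ 4w^(i+1) when w ≥ 2. -/
theorem sum_schneiderExponents_floor (hw : 2 ≤ w) (hε : ∀ j, ε j = 0 ∨ ε j = 1) (i N : ℕ)
    (hN : N + 1 = ⌊w ^ i⌋₊) :
    4 * i * ((N : ℝ) + 1) - 8 * w ^ i
      ≤ ((∑ k ∈ Finset.range N, schneiderExponents w η b ε (k + 1) : ℕ) : ℝ) ∧
    ((∑ k ∈ Finset.range N, schneiderExponents w η b ε (k + 1) : ℕ) : ℝ)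
      ≤ (4 * i + b + 3) * N := by
  induction i generalizing N with
  | zero =>
    obtain rfl : N = 0 := by simpa using hN
    simp
  | succ i ih =>
    have hlt := floor_pow_lt_succ hw i
    have hwi : 1 ≤ w ^ i := one_le_pow₀ (by linarith)
    have h1 : 1 ≤ ⌊w ^ i⌋₊ := Nat.le_floor (by exact_mod_cast hwi)
    obtain ⟨M, hM⟩ : ∃ M, M + 1 = ⌊w ^ i⌋₊ := ⟨⌊w ^ i⌋₊ - 1, by omega⟩
    obtain ⟨j, rfl⟩ : ∃ j, N = M + j := ⟨N - M, by omega⟩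
    obtain ⟨l1, u1⟩ := ih M hM
    obtain ⟨l2, u2⟩ := sum_schneiderExponents_step (η := η) (b := b) hw hε hM hN.le
    have l2' : ((∑ k ∈ Finset.range M, schneiderExponents w η b ε (k + 1) : ℕ) : ℝ) + 4 * i * j
      ≤ ((∑ k ∈ Finset.range (M + j), schneiderExponents w η b ε (k + 1) : ℕ) : ℝ) := by
      exact_mod_cast l2
    have u2' : ((∑ k ∈ Finset.range (M + j), schneiderExponents w η b ε (k + 1) : ℕ) : ℝ)
      ≤ ((∑ k ∈ Finset.range M, schneiderExponents w η b ε (k + 1) : ℕ) : ℝ)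
        + (4 * i + b + 3) * j := by
      exact_mod_cast u2
    have hN' : ((M : ℝ) + j) + 1 ≤ w ^ (i + 1) := by
      have := Nat.floor_le (show 0 ≤ w ^ (i + 1) by positivity)
      rw [← hN] at this
      exact_mod_cast this
    have hpow : 2 * w ^ i ≤ w ^ (i + 1) := by
      rw [pow_succ]
      nlinarith
    push_cast at *
    constructor
    · nlinarith
    · have : (0 : ℝ) ≤ M := M.cast_nonneg
      have : (0 : ℝ) ≤ j := j.cast_nonneg
      nlinarith

/-- The sum of the first `n` exponents is `4 * i * n` up to a multiple of `w ^ i` when `n` is in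
the block of index `i`. -/
theorem abs_sum_schneiderExponents_sub_le (hw : 2 ≤ w) (hε : ∀ j, ε j = 0 ∨ ε j = 1) {i n : ℕ}
    {c : ℝ} (h1 : ⌊w ^ i⌋₊ ≤ n + 1) (h2 : n + 1 ≤ ⌊w ^ (i + 1)⌋₊) (hn : c * w ^ i - 2 ≤ n)
    (hn' : n ≤ c * w ^ i) :
    |((∑ k ∈ Finset.range n, schneiderExponents w η b ε (k + 1) : ℕ) : ℝ)
      - 4 * c * (i * w ^ i)| ≤ ((b + 3) * c + 16) * w ^ i := by
  have hwi : 1 ≤ w ^ i := one_le_pow₀ (by linarith)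
  have hfl : 1 ≤ ⌊w ^ i⌋₊ := Nat.le_floor (by exact_mod_cast hwi)
  have hi : (i : ℝ) ≤ w ^ i := by
    have h : (2 : ℝ) ^ i ≤ w ^ i := pow_le_pow_left₀ (by norm_num) hw i
    have h' : (i : ℝ) ≤ 2 ^ i := by exact_mod_cast Nat.lt_two_pow_self.le
    linarith
  obtain ⟨M, hM⟩ : ∃ M, M + 1 = ⌊w ^ i⌋₊ := ⟨⌊w ^ i⌋₊ - 1, by omega⟩
  obtain ⟨j, rfl⟩ : ∃ j, n = M + j := ⟨n - M, by omega⟩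
  obtain ⟨l1, u1⟩ := sum_schneiderExponents_floor (η := η) (b := b) hw hε i M hM
  obtain ⟨l2, u2⟩ := sum_schneiderExponents_step (η := η) (b := b) hw hε hM h2
  have l2' : ((∑ k ∈ Finset.range M, schneiderExponents w η b ε (k + 1) : ℕ) : ℝ) + 4 * i * j
    ≤ ((∑ k ∈ Finset.range (M + j), schneiderExponents w η b ε (k + 1) : ℕ) : ℝ) := by
    exact_mod_cast l2
  have u2' : ((∑ k ∈ Finset.range (M + j), schneiderExponents w η b ε (k + 1) : ℕ) : ℝ)
    ≤ ((∑ k ∈ Finset.range M, schneiderExponents w η b ε (k + 1) : ℕ) : ℝ)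
      + (4 * i + b + 3) * j := by
    exact_mod_cast u2
  push_cast at hn hn'
  have hi0 : (0 : ℝ) ≤ i := i.cast_nonneg
  have hb0 : (0 : ℝ) ≤ b := b.cast_nonneg
  have m1 := mul_le_mul_of_nonneg_left hn hi0
  have m2 := mul_le_mul_of_nonneg_left hn' (show (0 : ℝ) ≤ 4 * i + b + 3 by positivity)
  have hnn : 0 ≤ c * w ^ i := le_trans (by positivity) hn'
  have hbc : 0 ≤ (b + 3) * (c * w ^ i) := by positivity
  rw [abs_le]
  constructor <;> nlinarith

end

/-! ### Quadratic approximations to `ξ` -/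

/-- A block contains at least one full period; 484 is 121d² at d = 2. -/
theorem floor_add_floor_lt {w η : ℝ} (hw : 484 ≤ w) (hη : 0 < η) (hηw : η ≤ √w / 2) (i : ℕ) :
    ⌊w ^ i⌋₊ + ⌊η * w ^ i⌋₊ < ⌊w ^ (i + 1)⌋₊ := by
  have hwi : 1 ≤ w ^ i := one_le_pow₀ (by linarith)
  have h1 := Nat.floor_le (show 0 ≤ w ^ i by linarith)
  have h2 := Nat.floor_le (show 0 ≤ η * w ^ i by positivity)
  refine Nat.lt_of_succ_le (Nat.le_floor ?_)
  have hsq := Real.sq_sqrt (show 0 ≤ w by linarith)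
  have h22 : 22 ≤ √w := Real.le_sqrt_of_sq_le (by linarith)
  have h3 : η + 2 ≤ w := by nlinarith
  push_cast
  rw [pow_succ]
  nlinarith

theorem exists_block_approximation {p : ℕ} [hp : Fact p.Prime] {w η : ℝ} {b : ℕ} {ε : ℕ → ℕ}
    (hw : 484 ≤ w) (hb : 1 ≤ b) (hε : ∀ j, ε j = 0 ∨ ε j = 1) (hη : 0 < η) (hηw : η ≤ √w / 2)
    {i : ℕ} (hi : 6 ≤ i) (hm : 2 ≤ ⌊η * w ^ i⌋₊) :
    ∃ (S₁ S₂ S₃ l : ℕ) (P : ℤ[X]) (α : ℚ_[p]),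
      |(S₁ : ℝ) - 4 * 1 * (i * w ^ i)| ≤ ((b + 3) * 1 + 16) * w ^ i ∧
      |(S₂ : ℝ) - 4 * (1 + η) * (i * w ^ i)| ≤ ((b + 3) * (1 + η) + 16) * w ^ i ∧
      |(S₃ : ℝ) - 4 * w * (i * w ^ i)| ≤ ((b + 3) * w + 16) * w ^ i ∧
      l ≤ b + 4 * i + 3 ∧
      Irreducible P ∧ P.natDegree = 2 ∧ aeval α P = 0 ∧
      ‖schneiderXi p w η b ε - α‖ = (p : ℝ)⁻¹ ^ (S₃ + l) ∧
      P.supNorm ^ 2 ≤ 4 * (p : ℝ) ^ (S₁ + S₂ + 18 * (⌊w ^ i⌋₊ + ⌊η * w ^ i⌋₊)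
        + 2 * schneiderExponents w η b ε 1) ∧
      (p : ℝ) ^ (2 * (S₁ + S₂))
        ≤ P.supNorm ^ 4 * (p : ℝ) ^ (14 * ⌊η * w ^ i⌋₊ + 13 * (b + 4 * i + 2) + 1) ∧
      (p : ℝ)⁻¹ ^ (S₁ + S₃ + l) ≤ ‖aeval (schneiderXi p w η b ε) P‖ ∧
      ‖aeval (schneiderXi p w η b ε) P‖
        ≤ (p : ℝ) ^ (2 * (b + 4 * i + 2)) * (p : ℝ)⁻¹ ^ (S₁ + S₃ + l) := by
  have hw2 : 2 ≤ w := by linarith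
  have hwi : 1 ≤ w ^ i := one_le_pow₀ (by linarith)
  have hfl1 : 1 ≤ ⌊w ^ i⌋₊ := Nat.le_floor (by exact_mod_cast hwi)
  have hlt := floor_add_floor_lt hw hη hηw i
  have f1 := Nat.floor_le (show 0 ≤ w ^ i by linarith)
  have f1' := Nat.lt_floor_add_one (w ^ i)
  have f2 := Nat.floor_le (show 0 ≤ η * w ^ i by positivity)
  have f2' := Nat.lt_floor_add_one (η * w ^ i)
  have f3 := Nat.floor_le (show 0 ≤ w ^ (i + 1) by positivity)
  have f3' := Nat.lt_floor_add_one (w ^ (i + 1))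
  have hεi := hε i
  have hfloor := schneiderExponents_floor hw2 η b ε i
  have hfloor' := schneiderExponents_floor hw2 η b ε (i + 1)
  have hper := fun j (hj : 0 < j) => schneiderExponents_add_period (η := η) (b := b) (ε := ε) hw2
    (i := i) hj
  have hmem := fun n (h1 : ⌊w ^ i⌋₊ ≤ n) => schneiderExponents_mem_block (η := η) (b := b) hw2 hε h1
  have hdvd := fun n => schneiderExponents_of_dvd hw2 η b ε (i := i) (n := n)
  have hndvd := fun n => schneiderExponents_of_not_dvd hw2 η b ε (i := i) (n := n)
  have hsum := fun n c => abs_sum_schneiderExponents_sub_le (η := η) (b := b) (n := n) (c := c)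
    hw2 hε (i := i)
  have hs1 := hsum ⌊w ^ i⌋₊ 1 (by omega) (by omega) (by linarith) (by linarith)
  have hs2 := hsum (⌊w ^ i⌋₊ + ⌊η * w ^ i⌋₊) (1 + η) (by omega) (by omega)
    (by push_cast; linarith) (by push_cast; linarith)
  have hs3 := hsum (⌊w ^ (i + 1)⌋₊ - 1) w (by omega) (by omega)
    (by rw [Nat.cast_sub (by omega)]; push_cast; rw [← pow_succ']; linarith)
    (by rw [Nat.cast_sub (by omega)]; push_cast; rw [← pow_succ']; linarith)
  set r := ⌊w ^ i⌋₊
  set s := ⌊η * w ^ i⌋₊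
  set M := ⌊w ^ (i + 1)⌋₊
  have hapos : ∀ k, 0 < schneiderExponents w η b ε (k + 1) := fun k => by
    simp only [schneiderExponents]
    split_ifs <;> omega
  -- Indices are shifted by one: position k carries the exponent a_(k+1). The preperiod of length r
  -- thus ends with b+4i+3, and the first disagreement is at M - 1. The condition 6 ≤ i gives e ≥
  -- 22.
  obtain ⟨P, α, hP⟩ := exists_quadratic_approximation (p := p)
    (a := fun k => schneiderExponents w η b ε (k + 1)) (r := r) (s := s) (e := b + 4 * i + ε i)
    (f := b + 4 * i + 2) (L := M - 1) hapos
    (fun k => (schneiderExponents_succ_le hw2 hε (by omega)).1)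
    (fun k => (schneiderExponents_succ_le hw2 hε (by omega)).2)
    (by omega) (by omega) (by omega) (by omega)
    (by
      simp only [Nat.sub_add_cancel hfl1, hfloor]
      omega)
    (fun k hk => hndvd _ (by omega) (by omega) (by
      rw [show r + k + 1 - r = k + 1 by omega]
      exact fun h => absurd (Nat.le_of_dvd (by omega) h) (by omega)))
    (hdvd _ (by omega) (by omega) (by rw [show r + (s - 1) + 1 - r = s by omega]))
    (by omega)
    (fun k hk => hper (k + 1) (by omega) (by omega))
    -- The continued period has exponent at most b+4i+3 there, whereas ξ has b+4(i+1)+3.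
    (by
      have h1 := hmem (r + (M - 1 - (r + s)) + 1) (by omega) (by omega)
      simp only [show M - 1 + 1 = M by omega, hfloor']
      omega)
  exact ⟨_, _, _, _, P, α, hs1, hs2, hs3, (hmem _ (by omega) (by omega)).2, hP⟩

/-- Linear bookkeeping with W = w^i, U = i w^i and q = log p: all lengths and single exponents are
O(W), so the main terms come from the S_j alone. -/
theorem log_bounds_of_approximation {q W U η w B f l r s t H x y : ℝ} {S₁ S₂ S₃ : ℝ}
    (hq : 0 < q) (hW : 1 ≤ W) (hη : 0 < η) (hw : 0 < w) (hB : 0 ≤ B) (ht : 0 ≤ t)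
    (h1 : |S₁ - 4 * 1 * U| ≤ (B * 1 + 16) * W) (h2 : |S₂ - 4 * (1 + η) * U| ≤ (B * (1 + η) + 16) * W)
    (h3 : |S₃ - 4 * w * U| ≤ (B * w + 16) * W) (hl0 : 0 ≤ l) (hl : l ≤ (B + 4) * W)
    (hf : f ≤ (B + 4) * W) (hr : r ≤ W) (hs : s ≤ η * W)
    (hH : 2 * H ≤ (S₁ + S₂ + 18 * (r + s) + 2 * t + 2) * q)
    (hH' : 2 * (S₁ + S₂) * q ≤ 4 * H + (14 * s + 13 * f + 1) * q)
    (hx : x = (S₃ + l) * q) (hy : y ≤ (S₁ + S₃ + l) * q) (hy' : (S₁ + S₃ + l - 2 * f) * q ≤ y) :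
    |H - 2 * (2 + η) * (U * q)| ≤ (B * (w + η) + 40 * (B + 1) * (1 + η) + t + 150) * (W * q) ∧
    |x - 4 * w * (U * q)| ≤ (B * (w + η) + 40 * (B + 1) * (1 + η) + t + 150) * (W * q) ∧
    |y - 4 * (w + 1) * (U * q)| ≤ (B * (w + η) + 40 * (B + 1) * (1 + η) + t + 150) * (W * q) := by
  have hW0 : 0 < W := by linarith
  have a1 : 0 ≤ B * W := by positivity
  have a2 : 0 ≤ η * W := by positivity
  have a3 : 0 ≤ B * η * W := by positivity
  have a4 : 0 ≤ B * w * W := by positivity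
  have a5 : t ≤ t * W := le_mul_of_one_le_right ht hW
  have a6 : 0 ≤ t * W := by positivity
  obtain ⟨h1l, h1u⟩ := abs_le.1 h1
  obtain ⟨h2l, h2u⟩ := abs_le.1 h2
  obtain ⟨h3l, h3u⟩ := abs_le.1 h3
  have conv : ∀ {z c K : ℝ}, |z / q - c * U| ≤ K * W → |z - c * (U * q)| ≤ K * (W * q) := by
    intro z c K h
    have e : z - c * (U * q) = (z / q - c * U) * q := by
      field_simp
    rw [e, abs_mul, abs_of_pos hq, ← mul_assoc]
    exact mul_le_mul_of_nonneg_right h hq.le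
  have hHq : H = H / q * q := by field_simp
  have hyq : y = y / q * q := by field_simp
  have b1 : 2 * (H / q) ≤ S₁ + S₂ + 18 * (r + s) + 2 * t + 2 := by
    rw [← mul_le_mul_iff_left₀ hq]
    linarith
  have b2 : 2 * (S₁ + S₂) ≤ 4 * (H / q) + (14 * s + 13 * f + 1) := by
    rw [← mul_le_mul_iff_left₀ hq]
    linarith
  have b3 : y / q ≤ S₁ + S₃ + l := by
    rw [← mul_le_mul_iff_left₀ hq]
    linarith
  have b4 : S₁ + S₃ + l - 2 * f ≤ y / q := by
    rw [← mul_le_mul_iff_left₀ hq]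
    linarith
  have b5 : x / q = S₃ + l := by
    rw [hx]
    field_simp
  refine ⟨conv (abs_le.2 ⟨?_, ?_⟩), conv (abs_le.2 ⟨?_, ?_⟩), conv (abs_le.2 ⟨?_, ?_⟩)⟩ <;>
    try rw [b5]
  all_goals linarith

/-- The error is smaller than the main term by a factor i. -/
theorem tendsto_div_of_abs_sub_le {w ℓ K c : ℝ} (hw : 1 < w) (hℓ : 0 < ℓ) {g : ℕ → ℝ}
    (h : ∀ᶠ i : ℕ in atTop, |g i - c * (i * w ^ i * ℓ)| ≤ K * (w ^ i * ℓ)) :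
    Tendsto (fun i : ℕ => g i / (i * w ^ i * ℓ)) atTop (𝓝 c) := by
  rw [tendsto_iff_norm_sub_tendsto_zero]
  refine squeeze_zero' (Eventually.of_forall fun _ => norm_nonneg _) ?_
    (tendsto_const_div_atTop_nhds_zero_nat K)
  filter_upwards [h, eventually_gt_atTop 0] with i hi hi0
  have hi' : (0 : ℝ) < i := by exact_mod_cast hi0
  have hT : 0 < i * w ^ i * ℓ := by positivity
  rw [Real.norm_eq_abs, div_sub' hT.ne', abs_div, abs_of_pos hT, div_le_div_iff₀ hT hi']
  calc |g i - i * w ^ i * ℓ * c| * i = |g i - c * (i * w ^ i * ℓ)| * i := by ring_nf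
    _ ≤ K * (w ^ i * ℓ) * i := by gcongr
    _ = _ := by ring

/-- With σ = √w ≥ 11d, the quantities n(4+2η) and 4+2η are O(σ). The Liouville exponent is then at
most 2 + 1.26σ, while the exponent to be beaten is at least 3.3σ. -/
theorem exponent_inequalities {w η d n : ℝ} (hd : 2 ≤ d) (hw : 121 * d ^ 2 ≤ w) (hη : 0 < η)
    (hηw : η < √w / d) (hn0 : 0 ≤ n) (hn : n ≤ d) :
    n * (2 * (2 + η)) < 4 * (w + 1) ∧
    2 * (1 + n * (2 * (2 + η)) * w / (4 * (w + 1) - n * (2 * (2 + η))))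
      < 4 * w / (2 * (2 + η)) := by
  set σ := √w with hσ
  have hw0 : 0 ≤ w := le_trans (by positivity) hw
  have hsq : σ ^ 2 = w := Real.sq_sqrt hw0
  have hσd : 11 * d ≤ σ := Real.le_sqrt_of_sq_le (by nlinarith)
  have hηd : η * d < σ := (lt_div_iff₀ (by linarith)).1 hηw
  have hσ22 : 22 ≤ σ := by linarith
  set x := n * (2 * (2 + η)) with hx
  have hx0 : 0 ≤ x := by positivity
  have hx1 : x ≤ 26 / 11 * σ := by
    have : x ≤ d * (2 * (2 + η)) := by rw [hx]; gcongr
    nlinarith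
  have hh : 2 * (2 + η) ≤ 13 / 11 * σ := by nlinarith
  have hden : 3.8 * σ ^ 2 ≤ 4 * (w + 1) - x := by nlinarith
  have hden0 : 0 < 4 * (w + 1) - x := lt_of_lt_of_le (by positivity) hden
  refine ⟨by linarith, ?_⟩
  have h1 : x * w / (4 * (w + 1) - x) ≤ 0.63 * σ := by
    rw [div_le_iff₀ hden0]
    calc x * w ≤ 26 / 11 * σ * σ ^ 2 := by rw [hsq]; gcongr
      _ ≤ 0.63 * σ * (3.8 * σ ^ 2) := by
        have : 0 < σ * σ ^ 2 := by positivity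
        nlinarith
      _ ≤ _ := by gcongr
  have h2 : 3.3 * σ ≤ 4 * w / (2 * (2 + η)) := by
    rw [le_div_iff₀ (by positivity)]
    calc 3.3 * σ * (2 * (2 + η)) ≤ 3.3 * σ * (13 / 11 * σ) := by gcongr
      _ ≤ 4 * w := by rw [← hsq]; nlinarith
  linarith

theorem exists_approximation_log_bounds {p : ℕ} [hp : Fact p.Prime] {w η : ℝ} {b : ℕ} {ε : ℕ → ℕ}
    (hw : 484 ≤ w) (hb : 1 ≤ b) (hε : ∀ j, ε j = 0 ∨ ε j = 1) (hη : 0 < η) (hηw : η ≤ √w / 2) :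
    ∃ K : ℝ, ∀ i : ℕ, 6 ≤ i → 2 ≤ ⌊η * w ^ i⌋₊ → ∃ (P : ℤ[X]) (α : ℚ_[p]),
      Irreducible P ∧ P.natDegree = 2 ∧ aeval α P = 0 ∧
      schneiderXi p w η b ε ≠ α ∧ aeval (schneiderXi p w η b ε) P ≠ 0 ∧
      |Real.log P.supNorm - 2 * (2 + η) * (i * w ^ i * Real.log p)|
        ≤ K * (w ^ i * Real.log p) ∧
      |-Real.log ‖schneiderXi p w η b ε - α‖ - 4 * w * (i * w ^ i * Real.log p)|
        ≤ K * (w ^ i * Real.log p) ∧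
      |-Real.log ‖aeval (schneiderXi p w η b ε) P‖ - 4 * (w + 1) * (i * w ^ i * Real.log p)|
        ≤ K * (w ^ i * Real.log p) := by
  have hp2 : (2 : ℝ) ≤ p := by exact_mod_cast hp.out.two_le
  have hp0 : (0 : ℝ) < p := by linarith
  have hq : 0 < Real.log p := Real.log_pos (by linarith)
  refine ⟨((b : ℝ) + 3) * (w + η) + 40 * ((b : ℝ) + 3 + 1) * (1 + η)
    + schneiderExponents w η b ε 1 + 150, fun i hi hm => ?_⟩
  obtain ⟨S₁, S₂, S₃, l, P, α, h1, h2, h3, hl, hirr, hdeg, hroot, hx, hH, hH', hy, hy'⟩ :=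
    exists_block_approximation (p := p) hw hb hε hη hηw hi hm
  have hwi : 1 ≤ w ^ i := one_le_pow₀ (by linarith)
  have hiw : (i : ℝ) ≤ w ^ i := by
    have h : (2 : ℝ) ^ i ≤ w ^ i := pow_le_pow_left₀ (by norm_num) (by linarith) i
    have h' : (i : ℝ) ≤ 2 ^ i := by exact_mod_cast Nat.lt_two_pow_self.le
    linarith
  have hxi : 0 < ‖schneiderXi p w η b ε - α‖ := by
    rw [hx]
    positivity
  have hev : 0 < ‖aeval (schneiderXi p w η b ε) P‖ := lt_of_lt_of_le (by positivity) hy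
  have hP0 : 0 < P.supNorm := one_pos.trans_le (one_le_supNorm hirr.ne_zero)
  refine ⟨P, α, hirr, hdeg, hroot, sub_ne_zero.1 (norm_pos_iff.1 hxi), norm_pos_iff.1 hev, ?_⟩
  have hbw : (b : ℝ) ≤ b * w ^ i := le_mul_of_one_le_right b.cast_nonneg hwi
  have hl' : (l : ℝ) ≤ b + 4 * i + 3 := by exact_mod_cast hl
  refine log_bounds_of_approximation (B := (b : ℝ) + 3) (f := ((b + 4 * i + 2 : ℕ) : ℝ))
    (l := l) (r := (⌊w ^ i⌋₊ : ℝ)) (s := (⌊η * w ^ i⌋₊ : ℝ))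
    (t := (schneiderExponents w η b ε 1 : ℝ)) hq hwi hη (by linarith) (by positivity)
    (Nat.cast_nonneg _) h1 h2 h3 (Nat.cast_nonneg _) ?_ ?_ (Nat.floor_le (by positivity))
    (Nat.floor_le (by positivity)) ?_ ?_ ?_ ?_ ?_
  · nlinarith
  · push_cast
    nlinarith
  · have h4 : P.supNorm ^ 2 ≤ (p : ℝ) ^ (S₁ + S₂ + 18 * (⌊w ^ i⌋₊ + ⌊η * w ^ i⌋₊)
        + 2 * schneiderExponents w η b ε 1 + 2) := by
      -- The factor 4 is at most p², which accounts for the extra 2 in the exponent.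
      refine hH.trans ?_
      rw [pow_add _ _ 2, mul_comm]
      gcongr
      nlinarith
    have h5 := Real.log_le_log (by positivity) h4
    rw [Real.log_pow, Real.log_pow] at h5
    exact_mod_cast h5
  · have h5 := Real.log_le_log (by positivity) hH'
    rw [Real.log_mul (by positivity) (by positivity), Real.log_pow, Real.log_pow,
      Real.log_pow] at h5
    exact_mod_cast h5
  · rw [hx, Real.log_pow, Real.log_inv]
    push_cast
    ring
  · have h5 := Real.log_le_log (by positivity) hy
    rw [Real.log_pow, Real.log_inv] at h5
    push_cast at h5
    linarith
  · have h5 := Real.log_le_log hev hy'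
    rw [Real.log_mul (by positivity) (by positivity), Real.log_pow, Real.log_pow,
      Real.log_inv] at h5
    push_cast at h5 ⊢
    linarith

theorem norm_schneiderXi_le_one (p : ℕ) [hp : Fact p.Prime] (w η : ℝ) {b : ℕ} (hb : 1 ≤ b)
    (ε : ℕ → ℕ) : ‖schneiderXi p w η b ε‖ ≤ 1 := by
  refine (norm_schneiderCF_lt_one fun k => ?_).le
  simp only [schneiderExponents]
  split_ifs <;> omega

theorem exists_quadraticApproximations {p : ℕ} [hp : Fact p.Prime] {w η : ℝ} {b : ℕ} {ε : ℕ → ℕ}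
    (hw : 484 ≤ w) (hb : 1 ≤ b) (hε : ∀ j, ε j = 0 ∨ ε j = 1) (hη : 0 < η) (hηw : η ≤ √w / 2) :
    ∃ (Q : ℕ → ℤ[X]) (α : ℕ → ℚ_[p]) (T : ℕ → ℝ),
      QuadraticApproximations (schneiderXi p w η b ε) Q T w (2 * (2 + η)) (4 * (w + 1)) ∧
      (∀ᶠ i in atTop, aeval (α i) (Q i) = 0) ∧ (∀ᶠ i in atTop, schneiderXi p w η b ε ≠ α i) ∧
      Tendsto (fun i => -Real.log ‖schneiderXi p w η b ε - α i‖ / T i) atTop (𝓝 (4 * w)) := by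
  have hw1 : 1 < w := by linarith
  have hq : 0 < Real.log p := Real.log_pos (by exact_mod_cast hp.out.one_lt)
  obtain ⟨K, hK⟩ := exists_approximation_log_bounds (p := p) hw hb hε hη hηw
  have hpow := tendsto_pow_atTop_atTop_of_one_lt hw1
  have hev : ∀ᶠ i : ℕ in atTop, 6 ≤ i ∧ 2 ≤ ⌊η * w ^ i⌋₊ := by
    filter_upwards [eventually_ge_atTop 6, (hpow.const_mul_atTop hη).eventually_ge_atTop 2]
      with i h1 h2
    exact ⟨h1, Nat.le_floor (by exact_mod_cast h2)⟩
  have hK' : ∀ i : ℕ, ∃ (P : ℤ[X]) (α : ℚ_[p]), 6 ≤ i ∧ 2 ≤ ⌊η * w ^ i⌋₊ → _ := fun i => by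
    by_cases h : 6 ≤ i ∧ 2 ≤ ⌊η * w ^ i⌋₊
    · obtain ⟨P, α, hP⟩ := hK i h.1 h.2
      exact ⟨P, α, fun _ => hP⟩
    -- Junk values for finitely many i; every property required of the sequence is asymptotic.
    · exact ⟨0, 0, fun h' => absurd h' h⟩
  choose Q α hQ using hK'
  have hall := hev.mono hQ
  refine ⟨Q, α, fun i => i * w ^ i * Real.log p, ⟨norm_schneiderXi_le_one p w η hb ε, by linarith,
    by linarith, ?_, ?_, hall.mono fun i h => h.1, hall.mono fun i h => h.2.1,
    hall.mono fun i h => h.2.2.2.2.1,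
    tendsto_div_of_abs_sub_le hw1 hq (hall.mono fun i h => h.2.2.2.2.2.1),
    tendsto_div_of_abs_sub_le hw1 hq (hall.mono fun i h => h.2.2.2.2.2.2.2)⟩,
    hall.mono fun i h => h.2.2.1, hall.mono fun i h => h.2.2.2.1,
    tendsto_div_of_abs_sub_le hw1 hq (hall.mono fun i h => h.2.2.2.2.2.2.1)⟩
  · exact (tendsto_natCast_atTop_atTop.atTop_mul_atTop₀ hpow).atTop_mul_const hq
  · have h1 : Tendsto (fun i : ℕ => (1 + 1 / (i : ℝ)) * w) atTop (𝓝 w) := by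
      simpa using (tendsto_one_div_atTop_nhds_zero_nat.const_add (1 : ℝ)).mul_const w
    refine h1.congr' ?_
    filter_upwards [eventually_gt_atTop 0] with i hi
    have : (0 : ℝ) < i := by exact_mod_cast hi
    have : 0 < w ^ i := by positivity
    push_cast
    field_simp
    ring

theorem mainTheorem12 (p : ℕ) [Fact p.Prime] (d : ℕ) (hd : 2 ≤ d)
    (w : ℝ) (hw : 121 * (d : ℝ) ^ 2 ≤ w) (b : ℕ) (hb : 1 ≤ b)
    (ε : ℕ → ℕ) (hε : ∀ j, ε j = 0 ∨ ε j = 1)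
    (η : ℝ) (hη : 0 < η) (hηw : η < √w / d) (n : ℕ) (hn : 2 ≤ n) (hnd : n ≤ d) :
    koksmaExponent p n (schneiderXi p w η b ε) = (((2 * w - 2 - η) / (2 + η) : ℝ) : EReal) ∧
    mahlerExponent p n (schneiderXi p w η b ε) = (((2 * w - η) / (2 + η) : ℝ) : EReal) ∧
    mahlerExponent p n (schneiderXi p w η b ε) - koksmaExponent p n (schneiderXi p w η b ε)
      = ((2 / (2 + η) : ℝ) : EReal) := by
  have hd2 : (2 : ℝ) ≤ d := by exact_mod_cast hd
  have hw484 : 484 ≤ w := by nlinarith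
  have hη2 : η ≤ √w / 2 := hηw.le.trans (div_le_div_of_nonneg_left (Real.sqrt_nonneg w)
    (by norm_num) hd2)
  obtain ⟨hnA, hE⟩ := exponent_inequalities hd2 hw hη hηw n.cast_nonneg
    (by exact_mod_cast hnd : (n : ℝ) ≤ d)
  obtain ⟨Q, α, T, hQ, hroot, hne, hB⟩ :=
    exists_quadraticApproximations (p := p) hw484 hb hε hη hη2
  have hK := hQ.koksmaExponent_eq hroot hne hB (by linarith) (by linarith) hn hnA hE
  -- The condition for `w_n` is weaker than that for `w_n^*`, since 4w ≤ 4(w+1).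
  have hM := hQ.mahlerExponent_eq hn hnA (hE.trans_le (by gcongr; linarith))
  have eK : 4 * w / (2 * (2 + η)) - 1 = (2 * w - 2 - η) / (2 + η) := by
    field_simp
    ring
  have eM : 4 * (w + 1) / (2 * (2 + η)) - 1 = (2 * w - η) / (2 + η) := by
    field_simp
    ring
  rw [eK] at hK
  rw [eM] at hM
  refine ⟨hK, hM, ?_⟩
  rw [hK, hM, ← EReal.coe_sub, EReal.coe_eq_coe_iff]
  field_simp
  ring
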